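/- **Definitions.** A group is locally finite if each of its finitely generated subgroups is finite. A metric on a countable group is proper if all closed balls are finite. A map $f:X\to Y$ of metric spaces is uniformly expansive if for every $R>0$ there is $S>0$ such that $d(x_1,x_2)\le R$ implies $d(f(x_1),f(x_2))\le S$; it is a coarse equivalence if it is uniformly expansive and there is a uniformly expansive $g:Y\to X$ such that $f\circ g$ and $g\circ f$ are at bounded distance from the respective identity maps. $X$ and $Y$ are bijectively coarsely equivalent if there is a bijective coarse equivalence $X\to Y$. For $p\in[1,\infty)$ and a bounded operator $T$ on the complex space $\ell^p(X)$ put $T_{xy}=(T\delta_y)(x)$ and $\mathrm{prop}(T)=\sup\{d(x,y):T_{xy}\neq0\}\in[0,\infty]$; the $\ell^p$ uniform Roe algebra $B^p_u(X)$ is the operator norm closure of the algebra of bounded operators on $\ell^p(X)$ with $\mathrm{prop}(T)<\infty$. It contains $\ell^\infty(X)$ as the algebra of pointwise multiplication operators. For a unital complex Banach algebra $A$, $K_0(A)$ is the Grothendieck group of the monoid (under diagonal sum) of idempotents $e$ in the matrix algebras $M_n(A)$, $n\in\mathbb N$, modulo algebraic equivalence ($e\sim f$ iff $e=xy$, $f=yx$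 for some rectangular matrices $x,y$ over $A$); $K_0(A)^+=\{[e]_0\}$ is the set of classes of idempotents, and $[1]_0$ is the class of the unit. Isometric isomorphisms are isometric isomorphisms of complex algebras; isomorphisms of triples $(K_0,K_0^+,[1]_0)$, or of pairs $(K_0,[1]_0)$, are group isomorphisms carrying the remaining data onto each other. **Theorem.** Let $\Gamma$ and $\Lambda$ be countable, locally finite groups with proper left-invariant metrics $d_\Gamma$ and $d_\Lambda$ respectively. Then the following conditions are equivalent: 1. $(\Gamma,d_\Gamma)$ and $(\Lambda,d_\Lambda)$ are bijectively coarsely equivalent. 2. For every $p\in[1,\infty)$, there is an isometric isomorphism $\phi:B^p_u(\Gamma)\to B^p_u(\Lambda)$ such that $\phi(\ell^\infty(\Gamma))=\ell^\infty(\Lambda)$. 3. $B^p_u(\Gamma)$ and $B^p_u(\Lambda)$ are isometrically isomorphic for every $p\in[1,\infty)$. 4. $B^p_u(\Gamma)$ and $B^p_u(\Lambda)$ are isometrically isomorphic for some $p\in[1,\infty)$. 5. For some $p\in[1,\infty)$, there is an isometric isomorphism $\phi:B^p_u(\Gamma)\to B^p_u(\Lambda)$ such that $\phi(\ell^\infty(\Gamma))=\ell^\infty(\Lambda)$.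 6. $(K_0(B^p_u(\Gamma)),K_0(B^p_u(\Gamma))^+,[1]_0)\cong(K_0(B^p_u(\Lambda)),K_0(B^p_u(\Lambda))^+,[1]_0)$ for every $p\in[1,\infty)$. 7. $(K_0(B^p_u(\Gamma)),K_0(B^p_u(\Gamma))^+,[1]_0)\cong(K_0(B^p_u(\Lambda)),K_0(B^p_u(\Lambda))^+,[1]_0)$ for some $p\in[1,\infty)$. 8. $(K_0(B^p_u(\Gamma)),[1]_0)\cong(K_0(B^p_u(\Lambda)),[1]_0)$ for every $p\in[1,\infty)$. 9. $(K_0(B^p_u(\Gamma)),[1]_0)\cong(K_0(B^p_u(\Lambda)),[1]_0)$ for some $p\in[1,\infty)$. -/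

import Mathlib

open scoped ENNReal NNReal

/-! ### Coarse geometry -/

section Coarse

universe u v

/-- A map between metric spaces is uniformly expansive if for every `R > 0` there is `S > 0` such
that points at distance at most `R` are sent to points at distance at most `S`. -/
def UniformlyExpansive {X : Type u} {Y : Type v} [MetricSpace X] [MetricSpace Y] (f : X → Y) :
    Prop :=
  ∀ R : ℝ, 0 < R → ∃ S : ℝ, 0 < S ∧ ∀ x₁ x₂ : X, dist x₁ x₂ ≤ R → dist (f x₁) (f x₂) ≤ S

/-- Two maps are close if they are at bounded distance from each other. -/
def CloseMaps {X : Type u} {Y : Type v} [MetricSpace Y] (f g : X → Y) : Prop :=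
  ∃ C : ℝ, 0 < C ∧ ∀ x : X, dist (f x) (g x) ≤ C

/-- A coarse equivalence: a uniformly expansive map with a uniformly expansive inverse up to
closeness. -/
def IsCoarseEquivalence {X : Type u} {Y : Type v} [MetricSpace X] [MetricSpace Y] (f : X → Y) :
    Prop :=
  UniformlyExpansive f ∧
    ∃ g : Y → X, UniformlyExpansive g ∧ CloseMaps (f ∘ g) id ∧ CloseMaps (g ∘ f) id

/-- `X` and `Y` are bijectively coarsely equivalent if some map `X → Y` is both a coarse
equivalence and a bijection. -/
def BijectivelyCoarselyEquivalent (X : Type u) (Y : Type v) [MetricSpace X] [MetricSpace Y] :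
    Prop :=
  ∃ f : X → Y, IsCoarseEquivalence f ∧ Function.Bijective f

/-- A (discrete) metric space is proper if all closed balls are finite. -/
def HasFiniteBalls (X : Type u) [MetricSpace X] : Prop :=
  ∀ (x : X) (r : ℝ), (Metric.closedBall x r).Finite

/-- A group is locally finite if all its finitely generated subgroups are finite. -/
def IsLocallyFiniteGroup (G : Type u) [Group G] : Prop :=
  ∀ H : Subgroup G, H.FG → Finite H

end Coarse

/-! ### The `ℓ^p` uniform Roe algebra -/

section Roe

universe u

/-- The complex Banach space `ℓ^p(X)`, for a finite exponent `p`. -/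
abbrev SeqSpace (p : ℝ≥0) (X : Type u) : Type u := lp (fun _ : X => ℂ) (p : ℝ≥0∞)

/-- The Banach algebra `B(ℓ^p(X))` of bounded operators on `ℓ^p(X)`. -/
abbrev SeqOp (p : ℝ≥0) [Fact (1 ≤ (p : ℝ≥0∞))] (X : Type u) : Type u :=
  SeqSpace p X →L[ℂ] SeqSpace p X

variable {p : ℝ≥0} [Fact (1 ≤ (p : ℝ≥0∞))] {X : Type u}

open Classical in
/-- The matrix coefficient `T_{xy} = (T δ_y)(x)`. -/
noncomputable def coeff (T : SeqOp p X) (x y : X) : ℂ :=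
  T (lp.single (p : ℝ≥0∞) y (1 : ℂ)) x

theorem coeff_add (S T : SeqOp p X) (x y : X) : coeff (S + T) x y = coeff S x y + coeff T x y :=
  rfl

open Classical in
theorem coeff_algebraMap (c : ℂ) (x y : X) :
    coeff (algebraMap ℂ (SeqOp p X) c) x y = if x = y then c else 0 := by
  have h : (algebraMap ℂ (SeqOp p X) c) (lp.single (p : ℝ≥0∞) y (1 : ℂ))
      = c • lp.single (p : ℝ≥0∞) y (1 : ℂ) := by
    rw [Algebra.algebraMap_eq_smul_one]; rfl
  unfold coeff
  rw [h, lp.coeFn_smul, Pi.smul_apply]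
  by_cases hxy : x = y
  · subst hxy
    rw [lp.single_apply_self]; simp
  · rw [lp.single_apply_ne _ _ _ hxy]; simp [hxy]

/-- A nonzero coefficient of a product comes from nonzero coefficients of the factors. -/
theorem exists_coeff_ne_zero_of_mul (S T : SeqOp p X) (x y : X) (h : coeff (S * T) x y ≠ 0) :
    ∃ z, coeff S x z ≠ 0 ∧ coeff T z y ≠ 0 := by
  classical
  by_contra! hz
  apply h
  set ξ : SeqSpace p X := T (lp.single (p : ℝ≥0∞) y (1 : ℂ)) with hξ
  have hsum : HasSum (fun z : X => lp.single (p : ℝ≥0∞) z (ξ z)) ξ :=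
    lp.hasSum_single ENNReal.coe_ne_top ξ
  have hS := (hsum.mapL S).mapL (lp.evalCLM ℂ (fun _ : X => ℂ) (p : ℝ≥0∞) x)
  have hterm : ∀ z : X, (lp.evalCLM ℂ (fun _ : X => ℂ) (p : ℝ≥0∞) x)
      (S (lp.single (p : ℝ≥0∞) z (ξ z))) = 0 := by
    intro z
    have h1 : lp.single (E := fun _ : X => ℂ) (p : ℝ≥0∞) z (ξ z)
        = ξ z • lp.single (E := fun _ : X => ℂ) (p : ℝ≥0∞) z (1 : ℂ) := by
      rw [← lp.single_smul]; simp
    have h2 : coeff S x z = (lp.evalCLM ℂ (fun _ : X => ℂ) (p : ℝ≥0∞) x)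
        (S (lp.single (p : ℝ≥0∞) z (1 : ℂ))) := by
      rfl
    have h3 : coeff T z y = ξ z := by
      rfl
    rw [h1, map_smul, map_smul, ← h2, ← h3, smul_eq_mul]
    by_cases h0 : coeff S x z = 0
    · simp [h0]
    · simp [hz z h0]
  have h4 : (lp.evalCLM ℂ (fun _ : X => ℂ) (p : ℝ≥0∞) x) (S ξ) = 0 := by
    refine hS.unique ?_
    simp only [hterm]
    exact hasSum_zero
  have h5 : coeff (S * T) x y = (lp.evalCLM ℂ (fun _ : X => ℂ) (p : ℝ≥0∞) x) (S ξ) := by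
    rfl
  rw [h5, h4]

/-- The operator of pointwise multiplication by a bounded function on `X`. -/
noncomputable def mulOp (p : ℝ≥0) [Fact (1 ≤ (p : ℝ≥0∞))] (f : lp (fun _ : X => ℂ) ∞) : SeqOp p X :=
  lp.mapCLM (p : ℝ≥0∞) (fun x : X => ContinuousLinearMap.mul ℂ ℂ (f x)) (norm_nonneg f)
    (fun x => (ContinuousLinearMap.opNorm_mul_apply_le ℂ ℂ (f x)).trans
      (lp.norm_apply_le_norm ENNReal.top_ne_zero f x))

theorem mulOp_apply (p : ℝ≥0) [Fact (1 ≤ (p : ℝ≥0∞))] (f : lp (fun _ : X => ℂ) ∞) (ξ : SeqSpace p X) (x : X) :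
    mulOp p f ξ x = f x * ξ x := rfl

variable [MetricSpace X]

/-- The propagation `sup {d(x,y) : T_{xy} ≠ 0} ∈ [0,∞]`. -/
noncomputable def propagation (T : SeqOp p X) : ℝ≥0∞ :=
  ⨆ (x : X) (y : X) (_ : coeff T x y ≠ 0), edist x y

theorem edist_le_propagation (T : SeqOp p X) {x y : X} (h : coeff T x y ≠ 0) :
    edist x y ≤ propagation T :=
  le_iSup_of_le x (le_iSup_of_le y (le_iSup_of_le h le_rfl))

theorem propagation_le (T : SeqOp p X) {r : ℝ≥0∞}
    (h : ∀ x y, coeff T x y ≠ 0 → edist x y ≤ r) : propagation T ≤ r :=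
  iSup_le fun x => iSup_le fun y => iSup_le fun hxy => h x y hxy

variable (p X)

/-- The algebra of bounded operators on `ℓ^p(X)` with finite propagation. -/
noncomputable def finitePropagation : Subalgebra ℂ (SeqOp p X) where
  carrier := {T | propagation T < ∞}
  mul_mem' := by
    intro S T hS hT
    refine lt_of_le_of_lt (propagation_le (S * T) (r := propagation S + propagation T) ?_)
      (ENNReal.add_lt_top.2 ⟨hS, hT⟩)
    intro x y h
    obtain ⟨z, h1, h2⟩ := exists_coeff_ne_zero_of_mul S T x y h
    exact (edist_triangle x z y).trans
      (add_le_add (edist_le_propagation S h1) (edist_le_propagation T h2))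
  add_mem' := by
    intro S T hS hT
    refine lt_of_le_of_lt (propagation_le (S + T) (r := max (propagation S) (propagation T)) ?_)
      (max_lt hS hT)
    intro x y h
    rw [coeff_add] at h
    by_cases h1 : coeff S x y = 0
    · rw [h1, zero_add] at h
      exact (edist_le_propagation T h).trans (le_max_right _ _)
    · exact (edist_le_propagation S h1).trans (le_max_left _ _)
  algebraMap_mem' := by
    intro c
    refine lt_of_le_of_lt (propagation_le _ (r := 0) ?_) ENNReal.zero_lt_top
    intro x y h
    rw [coeff_algebraMap] at h
    have hxy : x = y := by
      by_contra hne
      exact h (if_neg hne)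
    simp [hxy]

/-- The `ℓ^p` uniform Roe algebra `B^p_u(X)`: the operator norm closure of the algebra of finite
propagation operators. -/
noncomputable def uniformRoe : Subalgebra ℂ (SeqOp p X) := (finitePropagation p X).topologicalClosure

variable {X}

theorem mulOp_mem_uniformRoe (f : lp (fun _ : X => ℂ) ∞) : mulOp p f ∈ uniformRoe p X := by
  classical
  refine Subalgebra.le_topologicalClosure _ ?_
  refine lt_of_le_of_lt (propagation_le _ (r := 0) ?_) ENNReal.zero_lt_top
  intro x y h
  have hxy : x = y := by
    by_contra hne
    apply h
    unfold coeff
    rw [mulOp_apply, lp.single_apply_ne _ _ _ hne, mul_zero]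
  simp [hxy]

variable (X)

/-- The diagonal copy of `ℓ^∞(X)` in `B^p_u(X)`. -/
def diagonalPart : Set (uniformRoe p X) :=
  Set.range fun f : lp (fun _ : X => ℂ) ∞ =>
    (⟨mulOp p f, mulOp_mem_uniformRoe p f⟩ : uniformRoe p X)

end Roe

/-! ### The ordered `K₀` group of a unital ring -/

section KTheory

universe u

/-- Algebraic equivalence of square matrices, possibly of different sizes: `e = x y` and `f = y x`
for some rectangular matrices `x`, `y` over `A`. -/
def AlgEquivalent {A : Type u} [Ring A] {m n : Type} [Fintype m] [Fintype n]
    (e : Matrix m m A) (f : Matrix n n A) : Prop :=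
  ∃ (x : Matrix m n A) (y : Matrix n m A), e = x * y ∧ f = y * x

namespace AlgEquivalent

variable {A : Type u} [Ring A] {k l m n : Type} [Fintype k] [Fintype l] [Fintype m] [Fintype n]

theorem refl_of_idem {e : Matrix m m A} (he : IsIdempotentElem e) : AlgEquivalent e e :=
  ⟨e, e, he.symm, he.symm⟩

theorem symm {e : Matrix m m A} {f : Matrix n n A} (h : AlgEquivalent e f) :
    AlgEquivalent f e := by
  obtain ⟨x, y, h1, h2⟩ := h
  exact ⟨y, x, h2, h1⟩

theorem trans {e : Matrix l l A} {f : Matrix m m A} {g : Matrix n n A}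
    (he : IsIdempotentElem e) (hg : IsIdempotentElem g)
    (h : AlgEquivalent e f) (h' : AlgEquivalent f g) : AlgEquivalent e g := by
  obtain ⟨x, y, h1, h2⟩ := h
  obtain ⟨z, w, h3, h4⟩ := h'
  refine ⟨x * z, w * y, ?_, ?_⟩
  · calc e = e * e := he.symm
      _ = x * (y * x) * y := by rw [h1]; simp only [Matrix.mul_assoc]
      _ = x * (z * w) * y := by rw [← h2, h3]
      _ = x * z * (w * y) := by simp only [Matrix.mul_assoc]
  · calc g = g * g := hg.symm
      _ = w * (z * w) * z := by rw [h4]; simp only [Matrix.mul_assoc]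
      _ = w * (y * x) * z := by rw [← h3, h2]
      _ = w * y * (x * z) := by simp only [Matrix.mul_assoc]

theorem reindex {e : Matrix m m A} (he : IsIdempotentElem e) (σ : m ≃ n) :
    AlgEquivalent e (e.submatrix σ.symm σ.symm) := by
  refine ⟨e.submatrix id σ.symm, e.submatrix σ.symm id, ?_, ?_⟩
  · rw [Matrix.submatrix_mul_equiv e e id σ.symm id, he.eq, Matrix.submatrix_id_id]
  · rw [← Matrix.submatrix_mul e e σ.symm id σ.symm Function.bijective_id, he.eq]

theorem blockSum {e : Matrix k k A} {f : Matrix l l A} {e' : Matrix m m A} {f' : Matrix n n A}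
    (h : AlgEquivalent e f) (h' : AlgEquivalent e' f') :
    AlgEquivalent (Matrix.fromBlocks e 0 0 e') (Matrix.fromBlocks f 0 0 f') := by
  obtain ⟨x, y, h1, h2⟩ := h
  obtain ⟨z, w, h3, h4⟩ := h'
  refine ⟨Matrix.fromBlocks x 0 0 z, Matrix.fromBlocks y 0 0 w, ?_, ?_⟩
  · simp [Matrix.fromBlocks_multiply, h1, h3]
  · simp [Matrix.fromBlocks_multiply, h2, h4]

end AlgEquivalent

theorem isIdempotentElem_fromBlocks {A : Type u} [Ring A] {m n : Type} [Fintype m] [Fintype n]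
    {e : Matrix m m A} {f : Matrix n n A} (he : IsIdempotentElem e) (hf : IsIdempotentElem f) :
    IsIdempotentElem (Matrix.fromBlocks e 0 0 f) := by
  unfold IsIdempotentElem
  simp [Matrix.fromBlocks_multiply, he.eq, hf.eq]

theorem isIdempotentElem_submatrix {A : Type u} [Ring A] {m n : Type} [Fintype m] [Fintype n]
    {e : Matrix m m A} (he : IsIdempotentElem e) (σ : n ≃ m) :
    IsIdempotentElem (e.submatrix σ σ) := by
  unfold IsIdempotentElem
  rw [Matrix.submatrix_mul_equiv, he.eq]

variable (A : Type u) [Ring A]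

/-- Idempotents in the matrix algebras `M_n(A)`, `n ∈ ℕ`. -/
structure IdemMatrix where
  size : ℕ
  mat : Matrix (Fin size) (Fin size) A
  idem : IsIdempotentElem mat

instance idemMatrixSetoid : Setoid (IdemMatrix A) where
  r e f := AlgEquivalent e.mat f.mat
  iseqv :=
    { refl := fun e => AlgEquivalent.refl_of_idem e.idem
      symm := fun h => h.symm
      trans := fun {e _ g} h h' => AlgEquivalent.trans e.idem g.idem h h' }

/-- The monoid `V(A)` of algebraic equivalence classes of idempotents in matrix algebras
over `A`. -/
def IdemClass : Type u := Quotient (idemMatrixSetoid A)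

variable {A}

/-- The diagonal sum `e ⊕ f = diag(e, f)`. -/
def IdemMatrix.sum (e f : IdemMatrix A) : IdemMatrix A where
  size := e.size + f.size
  mat := (Matrix.fromBlocks e.mat 0 0 f.mat).submatrix finSumFinEquiv.symm finSumFinEquiv.symm
  idem := isIdempotentElem_submatrix (isIdempotentElem_fromBlocks e.idem f.idem) _

theorem IdemMatrix.sum_equiv_block (e f : IdemMatrix A) :
    AlgEquivalent (e.sum f).mat (Matrix.fromBlocks e.mat 0 0 f.mat) :=
  (AlgEquivalent.reindex (isIdempotentElem_fromBlocks e.idem f.idem) finSumFinEquiv).symm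

/-- The zero idempotent (of size `0`). -/
def IdemMatrix.empty : IdemMatrix A where
  size := 0
  mat := 0
  idem := IsIdempotentElem.zero

/-- The unit of `A`, as an idempotent in `M_1(A)`. -/
def IdemMatrix.unit : IdemMatrix A where
  size := 1
  mat := 1
  idem := IsIdempotentElem.one

theorem IdemMatrix.sum_congr {e e' f f' : IdemMatrix A} (h : AlgEquivalent e.mat e'.mat)
    (h' : AlgEquivalent f.mat f'.mat) : AlgEquivalent (e.sum f).mat (e'.sum f').mat := by
  have i1 := isIdempotentElem_fromBlocks e.idem f.idem
  have i2 := isIdempotentElem_fromBlocks e'.idem f'.idem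
  exact ((e.sum_equiv_block f).trans (e.sum f).idem i2 (h.blockSum h')).trans (e.sum f).idem
    (e'.sum f').idem (e'.sum_equiv_block f').symm

theorem IdemMatrix.sum_comm (e f : IdemMatrix A) :
    AlgEquivalent (e.sum f).mat (f.sum e).mat := by
  have i1 := isIdempotentElem_fromBlocks e.idem f.idem
  have i2 := isIdempotentElem_fromBlocks f.idem e.idem
  have h := AlgEquivalent.reindex i1 (Equiv.sumComm _ _)
  have h' : (Matrix.fromBlocks e.mat 0 0 f.mat).submatrix (Equiv.sumComm _ _).symm
      (Equiv.sumComm _ _).symm = Matrix.fromBlocks f.mat 0 0 e.mat := by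
    ext (i | i) (j | j) <;> rfl
  rw [h'] at h
  exact ((e.sum_equiv_block f).trans (e.sum f).idem i2 h).trans (e.sum f).idem
    (f.sum e).idem (f.sum_equiv_block e).symm

theorem IdemMatrix.empty_sum (e : IdemMatrix A) :
    AlgEquivalent ((IdemMatrix.empty : IdemMatrix A).sum e).mat e.mat := by
  have i1 := isIdempotentElem_fromBlocks (IdemMatrix.empty : IdemMatrix A).idem e.idem
  have : IsEmpty (Fin (IdemMatrix.empty : IdemMatrix A).size) := Fin.isEmpty
  have h : AlgEquivalent (Matrix.fromBlocks (IdemMatrix.empty : IdemMatrix A).mat 0 0 e.mat)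
      e.mat := by
    have h' := AlgEquivalent.reindex i1 (Equiv.emptySum _ (Fin e.size))
    convert h' using 1
    ext i j
    rfl
  exact (IdemMatrix.sum_equiv_block _ e).trans (IdemMatrix.sum _ e).idem e.idem h

theorem IdemMatrix.sum_assoc (e f g : IdemMatrix A) :
    AlgEquivalent ((e.sum f).sum g).mat (e.sum (f.sum g)).mat := by
  have i1 := isIdempotentElem_fromBlocks (isIdempotentElem_fromBlocks e.idem f.idem) g.idem
  have i2 := isIdempotentElem_fromBlocks e.idem (isIdempotentElem_fromBlocks f.idem g.idem)
  have a1 : AlgEquivalent ((e.sum f).sum g).mat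
      (Matrix.fromBlocks (Matrix.fromBlocks e.mat 0 0 f.mat) 0 0 g.mat) :=
    ((e.sum f).sum_equiv_block g).trans ((e.sum f).sum g).idem i1
      ((e.sum_equiv_block f).blockSum (AlgEquivalent.refl_of_idem g.idem))
  have a2 : AlgEquivalent (e.sum (f.sum g)).mat
      (Matrix.fromBlocks e.mat 0 0 (Matrix.fromBlocks f.mat 0 0 g.mat)) :=
    (e.sum_equiv_block (f.sum g)).trans (e.sum (f.sum g)).idem i2
      ((AlgEquivalent.refl_of_idem e.idem).blockSum (f.sum_equiv_block g))
  have h := AlgEquivalent.reindex i1 (Equiv.sumAssoc _ _ _)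
  have h' : (Matrix.fromBlocks (Matrix.fromBlocks e.mat 0 0 f.mat) 0 0 g.mat).submatrix
      (Equiv.sumAssoc _ _ _).symm (Equiv.sumAssoc _ _ _).symm
      = Matrix.fromBlocks e.mat 0 0 (Matrix.fromBlocks f.mat 0 0 g.mat) := by
    ext (i | i | i) (j | j | j) <;> rfl
  rw [h'] at h
  exact (a1.trans ((e.sum f).sum g).idem i2 h).trans ((e.sum f).sum g).idem
    (e.sum (f.sum g)).idem a2.symm

variable (A)

instance : Zero (IdemClass A) := ⟨Quotient.mk _ IdemMatrix.empty⟩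

instance : Add (IdemClass A) :=
  ⟨Quotient.map₂ IdemMatrix.sum fun _ _ h _ _ h' => IdemMatrix.sum_congr h h'⟩

theorem IdemClass.zero_add' (a : IdemClass A) : 0 + a = a :=
  Quotient.inductionOn a fun e => Quotient.sound (IdemMatrix.empty_sum e)

theorem IdemClass.add_comm' (a b : IdemClass A) : a + b = b + a :=
  Quotient.inductionOn₂ a b fun e f => Quotient.sound (IdemMatrix.sum_comm e f)

instance : AddCommMonoid (IdemClass A) where
  add_assoc a b c := Quotient.inductionOn₃ a b c fun e f g =>
    Quotient.sound (IdemMatrix.sum_assoc e f g)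
  zero_add := IdemClass.zero_add' A
  add_zero a := (IdemClass.add_comm' A a 0).trans (IdemClass.zero_add' A a)
  add_comm := IdemClass.add_comm' A
  nsmul := nsmulRec

/-- The group `K₀(A)`: the Grothendieck group of `V(A)`. -/
abbrev KZero : Type u := Algebra.GrothendieckAddGroup (IdemClass A)

variable {A}

/-- The class `[e]₀ ∈ K₀(A)` of an idempotent matrix over `A`. -/
def kClass (e : IdemMatrix A) : KZero A :=
  Algebra.GrothendieckAddGroup.of (Quotient.mk (idemMatrixSetoid A) e : IdemClass A)

variable (A)

/-- The positive cone `K₀(A)⁺ = {[e]₀ : e an idempotent matrix over A}`. -/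
def kPos : Set (KZero A) := Set.range (kClass (A := A))

/-- The class `[1]₀ ∈ K₀(A)` of the unit. -/
def kUnit : KZero A := kClass IdemMatrix.unit

end KTheory

section Isomorphisms

universe u v

/-- `(K₀(A), [1]₀) ≅ (K₀(B), [1]₀)`. -/
def KZeroUnitIso (A : Type u) (B : Type v) [Ring A] [Ring B] : Prop :=
  ∃ φ : KZero A ≃+ KZero B, φ (kUnit A) = kUnit B

/-- `(K₀(A), K₀(A)⁺, [1]₀) ≅ (K₀(B), K₀(B)⁺, [1]₀)`. -/
def KZeroOrderedUnitIso (A : Type u) (B : Type v) [Ring A] [Ring B] : Prop :=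
  ∃ φ : KZero A ≃+ KZero B, φ '' kPos A = kPos B ∧ φ (kUnit A) = kUnit B

/-- `B^p_u(X)` and `B^p_u(Y)` are isometrically isomorphic as Banach algebras. -/
def RoeIso (p : ℝ≥0) [Fact (1 ≤ (p : ℝ≥0∞))] (X : Type u) (Y : Type v)
    [MetricSpace X] [MetricSpace Y] : Prop :=
  ∃ φ : uniformRoe p X ≃ₐ[ℂ] uniformRoe p Y, Isometry φ

/-- There is an isometric isomorphism `φ : B^p_u(X) → B^p_u(Y)` with `φ(ℓ^∞(X)) = ℓ^∞(Y)`. -/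
def RoeDiagonalIso (p : ℝ≥0) [Fact (1 ≤ (p : ℝ≥0∞))] (X : Type u) (Y : Type v)
    [MetricSpace X] [MetricSpace Y] : Prop :=
  ∃ φ : uniformRoe p X ≃ₐ[ℂ] uniformRoe p Y,
    Isometry φ ∧ φ '' diagonalPart p X = diagonalPart p Y

end Isomorphisms

-- All nine conditions are governed by one arithmetic invariant: the set of divisors of the orders
-- of the finite subgroups generated by balls. The substantial implication is from an isomorphism of
-- the pairs `(K₀, [1]₀)`, for a single `p`, back to geometry; the others follow by conjugating with
-- permutation operators, by functoriality of `K₀`, or by forgetting data.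
--
-- The invariant can be read off from `K₀`. If `H` is a finite subgroup, right translations by `H`
-- cut the unit into `|H|` equivalent orthogonal idempotents, so `|H|` divides `[1]₀`
-- (`exists_card_nsmul_eq_kUnit`). Conversely, the Roe algebra is the closure of a union of algebras
-- of operators that are block diagonal over the cosets of ball subgroups. An idempotent matrix is
-- eventually close to one over such an algebra, whose rank on the identity block is a complex
-- matrix rank. These ranks form a homomorphism from `K₀` to germs of integer sequences which sends
-- `[1]₀` to the germ of the orders, so a divisor of `[1]₀` eventually divides the orders
-- (`MatricialApproximation.eventually_dvd_card`).
--
-- The invariant determines the group up to bijective coarse equivalence. The group can be numbered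
-- by an initial segment of `ℕ` so that the cosets of every ball subgroup are intervals of equal
-- length (`exists_coset_coordinates`). If the orders in two groups divide one another, matching
-- equal numbers sends cosets into cosets in both directions
-- (`bijectivelyCoarselyEquivalent_of_card_dvd`). No computation of `K₀` is needed.

/-! ### Coordinates on a locally finite group -/

section Coordinates

variable {G : Type*} [Group G]

/-- `b` numbers the elements of the last member `H n` of a chain of finite subgroups by the initial
segment of `ℕ` of the same length, in such a way that the left cosets of `H l`, `l ≤ n`, correspond
to the intervals `[j |H l|, (j + 1) |H l|)`. -/
structure IsCosetNumbering (H : ℕ → Subgroup G) (n : ℕ) (b : G → ℕ) : Prop where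
  bijOn : Set.BijOn b (H n) (Set.Iio (Nat.card (H n)))
  coset_iff : ∀ l ≤ n, ∀ x ∈ H n, ∀ y ∈ H n,
    (x⁻¹ * y ∈ H l ↔ b x / Nat.card (H l) = b y / Nat.card (H l))

variable {H : ℕ → Subgroup G}

/-- The intervals of length `m` refine those of length `n`. This is how divisibility of orders
becomes inclusion of cosets. -/
theorem Nat.div_eq_div_of_dvd_of_div_eq_div {a b m n : ℕ} (hmn : m ∣ n) (h : a / m = b / m) :
    a / n = b / n := by
  obtain ⟨k, rfl⟩ := hmn
  rw [← Nat.div_div_eq_div_mul, ← Nat.div_div_eq_div_mul, h]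

/-- A transversal of a finite subgroup `K` in a larger finite subgroup `L`: each element of `L`
has a representative in its left coset of `K`, and the cosets are numbered by the integers below
the index, `K` itself being represented by `1` and having number `0`. -/
theorem Subgroup.exists_numbered_transversal {K L : Subgroup G} [Finite L] (hKL : K ≤ L) :
    ∃ (s : G → G) (i : G → ℕ), (∀ x ∈ L, (s x)⁻¹ * x ∈ K) ∧ (∀ x ∈ L, s x ∈ L) ∧
      (∀ x ∈ L, ∀ y ∈ L, (x⁻¹ * y ∈ K → s x = s y)) ∧
      (∀ x ∈ L, ∀ y ∈ L, (x⁻¹ * y ∈ K ↔ i x = i y)) ∧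
      (∀ j, j * Nat.card K < Nat.card L → ∃ x ∈ L, i x = j) ∧
      (∀ x ∈ L, (i x + 1) * Nat.card K ≤ Nat.card L) ∧
      (∀ x ∈ K, s x = 1 ∧ i x = 0) := by
  classical
  set Q := L ⧸ K.subgroupOf L
  have hcard : Nat.card L = Nat.card Q * Nat.card K := by
    rw [Subgroup.card_eq_card_quotient_mul_card_subgroup (K.subgroupOf L),
      Nat.card_congr (Subgroup.subgroupOfEquivOfLe hKL).toEquiv]
  have : Finite Q := inferInstance
  have hQpos : 0 < Nat.card Q := Nat.card_pos
  have : Finite K := Finite.of_injective _ (Subgroup.inclusion_injective hKL)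
  have hKpos : 0 < Nat.card K := Nat.card_pos
  have : NeZero (Nat.card Q) := ⟨hQpos.ne'⟩
  -- The swap gives the trivial coset the number 0, and the update below gives it the representative
  -- 1; a numbering of `K` can then be extended without changing its values.
  obtain ⟨e, he⟩ : ∃ e : Q ≃ Fin (Nat.card Q), e ((1 : L) : Q) = 0 :=
    ⟨(Finite.equivFin Q).trans (Equiv.swap (Finite.equivFin Q ((1 : L) : Q)) 0), by simp⟩
  set r : Q → L := Function.update Quotient.out ((1 : L) : Q) 1
  have hr : ∀ q : Q, (r q : Q) = q := by
    intro q
    by_cases h : q = ((1 : L) : Q)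
    · simp [r, h]
    · simp only [r, Function.update_of_ne h]
      exact Quotient.out_eq q
  have hq : ∀ x y : L, (x : Q) = y ↔ (x : G)⁻¹ * y ∈ K := by
    intro x y
    rw [QuotientGroup.eq, Subgroup.mem_subgroupOf]
    rfl
  refine ⟨fun x => if h : x ∈ L then r ((⟨x, h⟩ : L) : Q) else 1,
    fun x => if h : x ∈ L then e ((⟨x, h⟩ : L) : Q) else 0, ?_, ?_, ?_, ?_, ?_, ?_, ?_⟩
  · intro x hx
    simp only [hx, dif_pos]
    exact (hq _ ⟨x, hx⟩).1 (hr _)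
  · intro x hx
    simp [hx]
  · intro x hx y hy h
    simp only [hx, hy, dif_pos]
    rw [(hq ⟨x, hx⟩ ⟨y, hy⟩).2 h]
  · intro x hx y hy
    simp only [hx, hy, dif_pos]
    rw [← hq ⟨x, hx⟩ ⟨y, hy⟩, ← Fin.ext_iff, e.injective.eq_iff]
  · intro j hj
    rw [hcard] at hj
    have hj' : j < Nat.card Q := lt_of_mul_lt_mul_right hj (Nat.zero_le _)
    refine ⟨r (e.symm ⟨j, hj'⟩), (r _).2, ?_⟩
    simp [hr]
  · intro x hx
    simp only [hx, dif_pos]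
    rw [hcard]
    exact Nat.mul_le_mul_right _ (e _).2
  · intro x hx
    have h1 : ((⟨x, hKL hx⟩ : L) : Q) = ((1 : L) : Q) := by
      rw [eq_comm, hq]
      simpa using hx
    simp [hKL hx, h1, he, r]

/-- The cosets of `H n` in `H (n + 1)` are laid end to end, each numbered by translating the
numbering `b` of `H n` by its representative. -/
theorem IsCosetNumbering.exists_extension (hH : Monotone H) [∀ n, Finite (H n)] {n : ℕ} {b : G → ℕ}
    (hb : IsCosetNumbering H n b) :
    ∃ b' : G → ℕ, IsCosetNumbering H (n + 1) b' ∧ ∀ x ∈ H n, b' x = b x := by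
  obtain ⟨s, i, hs, hsL, hss, hi, hisurj, hile, hone⟩ :=
    Subgroup.exists_numbered_transversal (L := H (n + 1)) (hH n.le_succ)
  set h := Nat.card (H n) with hh
  have hpos : 0 < h := Nat.card_pos
  have hlt : ∀ x ∈ H (n + 1), b ((s x)⁻¹ * x) < h := fun x hx => hb.bijOn.mapsTo (hs x hx)
  have hdiv : ∀ x ∈ H (n + 1), (i x * h + b ((s x)⁻¹ * x)) / h = i x := by
    intro x hx
    rw [add_comm, Nat.add_mul_div_right _ _ hpos, Nat.div_eq_of_lt (hlt x hx), zero_add]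
  have key : ∀ l ≤ n, ∀ x ∈ H (n + 1), ∀ y ∈ H (n + 1), i x = i y →
      (x⁻¹ * y ∈ H l ↔ (i x * h + b ((s x)⁻¹ * x)) / Nat.card (H l)
        = (i y * h + b ((s y)⁻¹ * y)) / Nat.card (H l)) := by
    intro l hl x hx y hy hxy
    have hsxy := hss x hx y hy ((hi x hx y hy).2 hxy)
    have hlpos : 0 < Nat.card (H l) := Nat.card_pos
    obtain ⟨k, hk⟩ : Nat.card (H l) ∣ h := Subgroup.card_dvd_of_le (hH hl)
    -- Since `|H l|` divides `h`, moving to the `a`-th copy of `H n` shifts by a whole number of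
    -- intervals of length `|H l|`, so the finer coset structure is preserved.
    have e1 : ∀ a c : ℕ, (a * h + c) / Nat.card (H l) = a * k + c / Nat.card (H l) := by
      intro a c
      rw [hk, mul_left_comm, Nat.mul_add_div hlpos]
    rw [e1, e1, hxy, Nat.add_left_cancel_iff, ← hb.coset_iff l hl _ (hs x hx) _ (hs y hy), hsxy]
    simp [mul_assoc]
  refine ⟨fun x => i x * h + b ((s x)⁻¹ * x), ⟨⟨?_, ?_, ?_⟩, ?_⟩, ?_⟩
  · intro x hx
    have h1 := hile x hx
    have h2 := hlt x hx
    simp only [Set.mem_Iio]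
    rw [add_mul, one_mul] at h1
    omega
  · intro x hx y hy hxy
    simp only at hxy
    have hixy : i x = i y := by rw [← hdiv x hx, hxy, hdiv y hy]
    have hsxy := hss x hx y hy ((hi x hx y hy).2 hixy)
    rw [hixy, Nat.add_left_cancel_iff] at hxy
    have := hb.bijOn.injOn (hs x hx) (hs y hy) hxy
    rwa [hsxy, mul_right_inj] at this
  · intro j hj
    obtain ⟨x, hx, hxj⟩ := hisurj (j / h) (lt_of_le_of_lt (Nat.div_mul_le_self j h) hj)
    obtain ⟨y, hy, hyj⟩ := hb.bijOn.surjOn (show j % h ∈ Set.Iio h from Nat.mod_lt _ hpos)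
    have hz : s x * y ∈ H (n + 1) := mul_mem (hsL x hx) (hH n.le_succ hy)
    have hxz : x⁻¹ * (s x * y) ∈ H n := by
      have := mul_mem (inv_mem (hs x hx)) hy
      simpa [mul_assoc] using this
    refine ⟨s x * y, hz, ?_⟩
    simp only
    rw [← (hi x hx _ hz).1 hxz, ← hss x hx _ hz hxz, inv_mul_cancel_left, hyj, hxj]
    exact Nat.div_add_mod' j h
  · intro l hl x hx y hy
    rcases Nat.lt_succ_iff_lt_or_eq.1 (Nat.lt_succ_of_le hl) with hl | rfl
    · have hl : l ≤ n := Nat.lt_succ_iff.1 hl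
      constructor
      · intro hxy
        exact (key l hl x hx y hy ((hi x hx y hy).1 (hH hl hxy))).1 hxy
      · intro hxy
        refine (key l hl x hx y hy ?_).2 hxy
        rw [← hdiv x hx, ← hdiv y hy]
        exact Nat.div_eq_div_of_dvd_of_div_eq_div (Subgroup.card_dvd_of_le (hH hl)) hxy
    -- For `l = n + 1` there is a single coset and a single interval.
    · refine iff_of_true (mul_mem (inv_mem hx) hy) ?_
      have : ∀ x ∈ H (n + 1), (i x * h + b ((s x)⁻¹ * x)) / Nat.card (H (n + 1)) = 0 := by
        intro x hx
        apply Nat.div_eq_of_lt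
        have h1 := hile x hx
        have h2 := hlt x hx
        rw [add_mul, one_mul] at h1
        omega
      rw [this x hx, this y hy]
  · intro x hx
    simp [hone x hx]

theorem IsCosetNumbering.exists_zero [Finite (H 0)] : ∃ b : G → ℕ, IsCosetNumbering H 0 b := by
  classical
  let e := Finite.equivFin (H 0)
  have hlt : ∀ x (hx : x ∈ H 0), (e ⟨x, hx⟩ : ℕ) < Nat.card (H 0) := fun x hx => (e _).2
  refine ⟨fun x => if h : x ∈ H 0 then e ⟨x, h⟩ else 0, ⟨?_, ?_, ?_⟩, ?_⟩
  · intro x hx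
    have hx : x ∈ H 0 := hx
    simp [hx]
  · intro x hx y hy hxy
    have hx : x ∈ H 0 := hx
    have hy : y ∈ H 0 := hy
    simpa [hx, hy, ← Fin.ext_iff] using hxy
  · intro j hj
    exact ⟨e.symm ⟨j, hj⟩, (e.symm ⟨j, hj⟩).2, by simp⟩
  · intro l hl x hx y hy
    obtain rfl : l = 0 := by omega
    refine iff_of_true (mul_mem (inv_mem hx) hy) ?_
    simp [hx, hy, Nat.div_eq_of_lt]

/-- A group exhausted by an increasing sequence of finite subgroups `H n` can be numbered injectively
by an initial segment of `ℕ` in such a way that the left cosets of `H n` are the intervals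
`[j |H n|, (j + 1) |H n|)`. -/
theorem exists_coset_coordinates (hH : Monotone H) [∀ n, Finite (H n)] (hex : ∀ x, ∃ n, x ∈ H n) :
    ∃ b : G → ℕ, Function.Injective b ∧
      (∀ j, j ∈ Set.range b ↔ ∃ n, j < Nat.card (H n)) ∧
      ∀ n x y, x⁻¹ * y ∈ H n ↔ b x / Nat.card (H n) = b y / Nat.card (H n) := by
  choose! F hF hFe using fun (n : ℕ) (b : G → ℕ) (hb : IsCosetNumbering H n b) =>
    hb.exists_extension hH
  obtain ⟨b₀, hb₀⟩ := IsCosetNumbering.exists_zero (H := H)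
  -- Successive extensions agree where both are meaningful, so evaluating `β` at any stage
  -- containing `x` gives the limit numbering.
  let β : ℕ → G → ℕ := fun n => Nat.rec b₀ F n
  have hβ : ∀ n, IsCosetNumbering H n (β n) := by
    intro n
    induction n with
    | zero => exact hb₀
    | succ n ih => exact hF n _ ih
  have hle : ∀ n m, n ≤ m → ∀ x ∈ H n, β m x = β n x := by
    intro n m hnm x hx
    induction m, hnm using Nat.le_induction with
    | base => rfl
    | succ m hm ih => rw [← ih]; exact hFe m _ (hβ m) x (hH hm hx)
  choose N hN using hex
  have hb : ∀ n x, x ∈ H n → β (N x) x = β n x := by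
    intro n x hx
    rw [← hle (N x) _ (le_max_left _ n) x (hN x), hle n _ (le_max_right _ _) x hx]
  have hmem : ∀ x n, ∀ k, max (N x) n ≤ k → x ∈ H k := fun x n k hk =>
    hH ((le_max_left _ _).trans hk) (hN x)
  refine ⟨fun x => β (N x) x, ?_, ?_, ?_⟩
  · intro x y hxy
    simp only at hxy
    have hx : x ∈ H (max (N x) (N y)) := hH (le_max_left _ _) (hN x)
    have hy : y ∈ H (max (N x) (N y)) := hH (le_max_right _ _) (hN y)
    rw [hb _ x hx, hb _ y hy] at hxy
    exact (hβ _).bijOn.injOn hx hy hxy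
  · intro j
    constructor
    · rintro ⟨x, rfl⟩
      exact ⟨N x, (hβ _).bijOn.mapsTo (hN x)⟩
    · rintro ⟨n, hn⟩
      obtain ⟨x, hx, hxj⟩ := (hβ n).bijOn.surjOn hn
      exact ⟨x, (hb n x hx).trans hxj⟩
  · intro n x y
    set k := max n (max (N x) (N y))
    have hx : x ∈ H k := hH ((le_max_left _ _).trans (le_max_right _ _)) (hN x)
    have hy : y ∈ H k := hH ((le_max_right _ _).trans (le_max_right _ _)) (hN y)
    simp only [hb k x hx, hb k y hy]
    exact (hβ k).coset_iff n (le_max_left _ _) x hx y hy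

end Coordinates

/-! ### Bijective coarse equivalence of locally finite groups -/

section Groups

/-- The subgroup generated by the closed ball of radius `n` about the identity. -/
def ballSubgroup (G : Type*) [Group G] [MetricSpace G] (n : ℕ) : Subgroup G :=
  Subgroup.closure (Metric.closedBall 1 n)

variable {G : Type*} [Group G] [MetricSpace G]

theorem ballSubgroup_monotone : Monotone (ballSubgroup G) := fun _ _ h =>
  Subgroup.closure_mono (Metric.closedBall_subset_closedBall (by exact_mod_cast h))

theorem finite_ballSubgroup (hG : IsLocallyFiniteGroup G) (hGp : HasFiniteBalls G) (n : ℕ) :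
    Finite (ballSubgroup G n) :=
  hG _ ⟨(hGp 1 n).toFinset, by simp [ballSubgroup]⟩

theorem exists_mem_ballSubgroup (x : G) : ∃ n, x ∈ ballSubgroup G n := by
  obtain ⟨n, hn⟩ := exists_nat_ge (dist x 1)
  exact ⟨n, Subgroup.subset_closure hn⟩

theorem inv_mul_mem_ballSubgroup [IsIsometricSMul G G] {x y : G} {n : ℕ} (h : dist x y ≤ n) :
    x⁻¹ * y ∈ ballSubgroup G n := by
  refine Subgroup.subset_closure ?_
  rw [Metric.mem_closedBall, dist_comm, ← dist_smul x]
  simpa using h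

/-- By left invariance, distances within a left coset of `K` are distances from 1 to elements of
`K`. With `inv_mul_mem_ballSubgroup`, this translates bounded distance into lying in a common coset
and back. -/
theorem exists_dist_le_of_inv_mul_mem [IsIsometricSMul G G] (K : Subgroup G) [Finite K] :
    ∃ S : ℝ, 0 < S ∧ ∀ x y : G, x⁻¹ * y ∈ K → dist x y ≤ S := by
  obtain ⟨S, hS⟩ := (Set.finite_range fun k : K => dist (1 : G) k).bddAbove
  refine ⟨max S 1, by positivity, fun x y h => ?_⟩
  rw [← dist_smul x⁻¹]
  refine le_trans ?_ (le_max_left _ _)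
  simpa using hS ⟨⟨_, h⟩, rfl⟩

variable {L : Type*} [Group L] [MetricSpace L] [IsIsometricSMul G G] [IsIsometricSMul L L]

theorem uniformlyExpansive_of_coset_map (hL : IsLocallyFiniteGroup L) (hLp : HasFiniteBalls L)
    (f : G → L) (hf : ∀ n, ∃ m, ∀ x y, x⁻¹ * y ∈ ballSubgroup G n →
      (f x)⁻¹ * f y ∈ ballSubgroup L m) : UniformlyExpansive f := by
  intro R _
  obtain ⟨n, hn⟩ := exists_nat_ge R
  obtain ⟨m, hm⟩ := hf n
  have := finite_ballSubgroup hL hLp m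
  obtain ⟨S, hS, hS'⟩ := exists_dist_le_of_inv_mul_mem (ballSubgroup L m)
  exact ⟨S, hS, fun x y hxy => hS' _ _ (hm x y (inv_mul_mem_ballSubgroup (hxy.trans hn)))⟩

theorem Equiv.bijectivelyCoarselyEquivalent {X Y : Type*} [MetricSpace X] [MetricSpace Y]
    (f : X ≃ Y) (hf : UniformlyExpansive f) (hg : UniformlyExpansive f.symm) :
    BijectivelyCoarselyEquivalent X Y :=
  ⟨f, ⟨hf, f.symm, hg, ⟨1, one_pos, by simp⟩, ⟨1, one_pos, by simp⟩⟩, f.bijective⟩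

/-- Locally finite groups whose finite subgroups have the same orders up to divisibility are
bijectively coarsely equivalent. -/
theorem bijectivelyCoarselyEquivalent_of_card_dvd
    (hG : IsLocallyFiniteGroup G) (hGp : HasFiniteBalls G)
    (hL : IsLocallyFiniteGroup L) (hLp : HasFiniteBalls L)
    (hGL : ∀ n, ∃ m, Nat.card (ballSubgroup G n) ∣ Nat.card (ballSubgroup L m))
    (hLG : ∀ n, ∃ m, Nat.card (ballSubgroup L n) ∣ Nat.card (ballSubgroup G m)) :
    BijectivelyCoarselyEquivalent G L := by
  have := finite_ballSubgroup hG hGp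
  have := finite_ballSubgroup hL hLp
  obtain ⟨b, hb, hbr, hbc⟩ := exists_coset_coordinates (ballSubgroup_monotone (G := G))
    exists_mem_ballSubgroup
  obtain ⟨c, hc, hcr, hcc⟩ := exists_coset_coordinates (ballSubgroup_monotone (G := L))
    exists_mem_ballSubgroup
  -- Both ranges are unions of initial segments whose lengths are the orders of ball subgroups;
  -- divisibility in both directions makes these lengths cofinal in one another.
  have hrange : Set.range b = Set.range c := by
    ext j
    rw [hbr, hcr]
    constructor
    · rintro ⟨n, hn⟩
      obtain ⟨m, hm⟩ := hGL n
      exact ⟨m, hn.trans_le (Nat.le_of_dvd Nat.card_pos hm)⟩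
    · rintro ⟨n, hn⟩
      obtain ⟨m, hm⟩ := hLG n
      exact ⟨m, hn.trans_le (Nat.le_of_dvd Nat.card_pos hm)⟩
  -- The bijection matching elements with equal numbers, characterised by `c ∘ f = b`.
  let f : G ≃ L := (Equiv.ofInjective b hb).trans
    ((Equiv.setCongr hrange).trans (Equiv.ofInjective c hc).symm)
  have hf : ∀ x, c (f x) = b x := fun x =>
    Equiv.apply_ofInjective_symm hc (Equiv.setCongr hrange (Equiv.ofInjective b hb x))
  have hf' : ∀ y, b (f.symm y) = c y := fun y => by rw [← hf, f.apply_symm_apply]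
  refine f.bijectivelyCoarselyEquivalent (uniformlyExpansive_of_coset_map hL hLp f fun n => ?_)
    (uniformlyExpansive_of_coset_map hG hGp f.symm fun n => ?_)
  · obtain ⟨m, hm⟩ := hGL n
    refine ⟨m, fun x y hxy => ?_⟩
    rw [hcc, hf, hf]
    exact Nat.div_eq_div_of_dvd_of_div_eq_div hm ((hbc n x y).1 hxy)
  · obtain ⟨m, hm⟩ := hLG n
    refine ⟨m, fun x y hxy => ?_⟩
    rw [hbc, hf', hf']
    exact Nat.div_eq_div_of_dvd_of_div_eq_div hm ((hcc n x y).1 hxy)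

end Groups

/-! ### Permutation operators -/

section Permutation

variable (p : ℝ≥0) [Fact (1 ≤ (p : ℝ≥0∞))] {X Y : Type*}

/-- A bijection `X ≃ Y` induces an isometric isomorphism `ℓ^p(X) ≃ ℓ^p(Y)`. -/
noncomputable def permIsometry (e : X ≃ Y) : SeqSpace p X ≃ₗᵢ[ℂ] SeqSpace p Y where
  toFun ξ := ⟨fun y => ξ (e.symm y), by
    have hp : 0 < (p : ℝ≥0∞).toReal := ENNReal.toReal_pos
      (zero_lt_one.trans_le Fact.out).ne' ENNReal.coe_ne_top
    exact (memℓp_gen_iff hp).2 (((lp.memℓp ξ).summable hp).comp_injective e.symm.injective)⟩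
  invFun ξ := ⟨fun x => ξ (e x), by
    have hp : 0 < (p : ℝ≥0∞).toReal := ENNReal.toReal_pos
      (zero_lt_one.trans_le Fact.out).ne' ENNReal.coe_ne_top
    exact (memℓp_gen_iff hp).2 (((lp.memℓp ξ).summable hp).comp_injective e.injective)⟩
  map_add' _ _ := rfl
  map_smul' _ _ := rfl
  left_inv ξ := by
    apply lp.ext
    funext x
    exact congrArg ξ (e.symm_apply_apply x)
  right_inv ξ := by
    apply lp.ext
    funext x
    exact congrArg ξ (e.apply_symm_apply x)
  norm_map' ξ := by
    have hp : 0 < (p : ℝ≥0∞).toReal := ENNReal.toReal_pos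
      (zero_lt_one.trans_le Fact.out).ne' ENNReal.coe_ne_top
    rw [lp.norm_eq_tsum_rpow hp, lp.norm_eq_tsum_rpow hp]
    congr 1
    exact e.symm.tsum_eq (fun x => ‖ξ x‖ ^ (p : ℝ≥0∞).toReal)

variable {p}

theorem permIsometry_apply (e : X ≃ Y) (ξ : SeqSpace p X) (y : Y) :
    permIsometry p e ξ y = ξ (e.symm y) := rfl

theorem permIsometry_symm_apply (e : X ≃ Y) (ξ : SeqSpace p Y) (x : X) :
    (permIsometry p e).symm ξ x = ξ (e x) := rfl

open Classical in
theorem permIsometry_symm_single (e : X ≃ Y) (x : X) :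
    (permIsometry p e).symm (lp.single (p : ℝ≥0∞) (e x) (1 : ℂ)) = lp.single (p : ℝ≥0∞) x 1 := by
  apply lp.ext
  funext z
  rw [permIsometry_symm_apply, lp.single_apply, lp.single_apply]
  by_cases h : x = z
  · subst h; simp
  · simp [Ne.symm h]

variable (p) in
/-- Conjugation by the permutation operator of a bijection. -/
noncomputable def permConj (e : X ≃ Y) : SeqOp p X ≃A[ℂ] SeqOp p Y :=
  (permIsometry p e).toContinuousLinearEquiv.conjContinuousAlgEquiv

theorem permConj_apply (e : X ≃ Y) (T : SeqOp p X) (ξ : SeqSpace p Y) :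
    permConj p e T ξ = permIsometry p e (T ((permIsometry p e).symm ξ)) := rfl

theorem permConj_symm_apply (e : X ≃ Y) (T : SeqOp p Y) (ξ : SeqSpace p X) :
    (permConj p e).symm T ξ = (permIsometry p e).symm (T (permIsometry p e ξ)) := rfl

theorem coeff_permConj (e : X ≃ Y) (T : SeqOp p X) (x y : X) :
    coeff (permConj p e T) (e x) (e y) = coeff T x y := by
  unfold coeff
  rw [permConj_apply, permIsometry_apply, permIsometry_symm_single, e.symm_apply_apply]

theorem isometry_permConj (e : X ≃ Y) : Isometry (permConj p e : SeqOp p X → SeqOp p Y) := by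
  have hle : ∀ T : SeqOp p X, ‖permConj p e T‖ ≤ ‖T‖ := by
    intro T
    refine ContinuousLinearMap.opNorm_le_bound _ (norm_nonneg _) fun ξ => ?_
    rw [permConj_apply, LinearIsometryEquiv.norm_map]
    refine (T.le_opNorm _).trans ?_
    rw [LinearIsometryEquiv.norm_map]
  have hle' : ∀ T : SeqOp p Y, ‖(permConj p e).symm T‖ ≤ ‖T‖ := by
    intro T
    refine ContinuousLinearMap.opNorm_le_bound _ (norm_nonneg _) fun ξ => ?_
    rw [permConj_symm_apply, LinearIsometryEquiv.norm_map]
    refine (T.le_opNorm _).trans ?_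
    rw [LinearIsometryEquiv.norm_map]
  refine AddMonoidHomClass.isometry_of_norm (permConj p e) fun T => le_antisymm (hle T) ?_
  simpa using hle' (permConj p e T)

theorem permConj_mulOp (e : X ≃ Y) (f : lp (fun _ : X => ℂ) ∞) (g : lp (fun _ : Y => ℂ) ∞)
    (h : ∀ x, g (e x) = f x) : permConj p e (mulOp p f) = mulOp p g := by
  ext ξ y
  obtain ⟨x, rfl⟩ := e.surjective y
  rw [permConj_apply, permIsometry_apply, mulOp_apply, mulOp_apply, h, e.symm_apply_apply,
    permIsometry_symm_apply]

variable [MetricSpace X] [MetricSpace Y]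

theorem mem_finitePropagation_iff {T : SeqOp p X} :
    T ∈ finitePropagation p X ↔ ∃ R : ℝ, 0 < R ∧ ∀ x y, coeff T x y ≠ 0 → dist x y ≤ R := by
  change propagation T < ∞ ↔ _
  constructor
  · intro h
    -- The maximum with 1 makes the radius positive, as `UniformlyExpansive` demands, even for
    -- propagation 0.
    refine ⟨max (propagation T).toReal 1, by positivity, fun x y hxy => le_max_of_le_left ?_⟩
    rw [dist_edist]
    exact ENNReal.toReal_mono h.ne (edist_le_propagation T hxy)
  · rintro ⟨R, _, hR⟩
    refine lt_of_le_of_lt (propagation_le T (r := ENNReal.ofReal R) fun x y hxy => ?_)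
      ENNReal.ofReal_lt_top
    rw [edist_dist]
    exact ENNReal.ofReal_le_ofReal (hR x y hxy)

/-- Conjugation only relabels matrix coefficients, so expansivity of `e` preserves finite
propagation; continuity handles the closure. -/
theorem permConj_mem_uniformRoe (e : X ≃ Y) (he : UniformlyExpansive e) {T : SeqOp p X}
    (hT : T ∈ uniformRoe p X) : permConj p e T ∈ uniformRoe p Y := by
  refine map_mem_closure (permConj p e).continuous hT fun S hS => ?_
  obtain ⟨R, hR, hS⟩ := mem_finitePropagation_iff.1 hS
  obtain ⟨R', hR', he⟩ := he R hR
  refine mem_finitePropagation_iff.2 ⟨R', hR', fun x y hxy => ?_⟩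
  obtain ⟨x, rfl⟩ := e.surjective x
  obtain ⟨y, rfl⟩ := e.surjective y
  rw [coeff_permConj] at hxy
  exact he _ _ (hS _ _ hxy)

variable (p) in
/-- The isomorphism of uniform Roe algebras induced by a bijective coarse equivalence. -/
noncomputable def roeEquiv (e : X ≃ Y) (he : UniformlyExpansive e)
    (he' : UniformlyExpansive e.symm) : uniformRoe p X ≃ₐ[ℂ] uniformRoe p Y where
  toFun T := ⟨permConj p e T, permConj_mem_uniformRoe e he T.2⟩
  invFun T := ⟨permConj p e.symm T, permConj_mem_uniformRoe e.symm he' T.2⟩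
  left_inv T := Subtype.ext ((permConj p e).symm_apply_apply T)
  right_inv T := Subtype.ext ((permConj p e).apply_symm_apply T)
  map_mul' S T := Subtype.ext (map_mul (permConj p e) (S : SeqOp p X) T)
  map_add' S T := Subtype.ext (map_add (permConj p e) (S : SeqOp p X) T)
  commutes' c := Subtype.ext ((permConj p e).toAlgEquiv.commutes c)

theorem roeEquiv_diagonalPart (e : X ≃ Y) (he : UniformlyExpansive e)
    (he' : UniformlyExpansive e.symm) :
    roeEquiv p e he he' '' diagonalPart p X = diagonalPart p Y := by
  have hbdd : ∀ f : lp (fun _ : X => ℂ) ∞, Memℓp (fun y => f (e.symm y)) ∞ := fun f =>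
    memℓp_infty ((lp.memℓp f).bddAbove.mono (Set.range_comp_subset_range e.symm fun x => ‖f x‖))
  have hbdd' : ∀ g : lp (fun _ : Y => ℂ) ∞, Memℓp (fun x => g (e x)) ∞ := fun g =>
    memℓp_infty ((lp.memℓp g).bddAbove.mono (Set.range_comp_subset_range e fun x => ‖g x‖))
  apply Set.Subset.antisymm
  · rintro _ ⟨_, ⟨f, rfl⟩, rfl⟩
    refine ⟨⟨_, hbdd f⟩, Subtype.ext (permConj_mulOp e f _ fun x => ?_).symm⟩
    exact congrArg f (e.symm_apply_apply x)
  · rintro _ ⟨g, rfl⟩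
    exact ⟨_, ⟨⟨_, hbdd' g⟩, rfl⟩, Subtype.ext (permConj_mulOp e _ g fun x => rfl)⟩

/-- A bijective coarse equivalence comes with a coarse inverse that need not be its inverse map. The
inverse map is close to it, and so inherits expansivity. -/
theorem UniformlyExpansive.of_closeMaps {f g : X → Y} (hf : UniformlyExpansive f)
    (h : CloseMaps f g) : UniformlyExpansive g := by
  obtain ⟨C, hC, h⟩ := h
  intro R hR
  obtain ⟨S, hS, hf⟩ := hf R hR
  refine ⟨C + S + C, by positivity, fun x y hxy => ?_⟩
  calc dist (g x) (g y) ≤ dist (g x) (f x) + dist (f x) (f y) + dist (f y) (g y) :=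
        dist_triangle4 _ _ _ _
    _ ≤ C + S + C := by
        gcongr
        · rw [dist_comm]; exact h x
        · exact hf x y hxy
        · exact h y

theorem RoeDiagonalIso.of_bijectivelyCoarselyEquivalent
    (h : BijectivelyCoarselyEquivalent X Y) : RoeDiagonalIso p X Y := by
  obtain ⟨f, ⟨hf, g, hg, -, C, hC, hgf⟩, hb⟩ := h
  set e := Equiv.ofBijective f hb
  have he' : UniformlyExpansive e.symm := by
    refine hg.of_closeMaps ⟨C, hC, fun y => ?_⟩
    obtain ⟨x, rfl⟩ := hb.surjective y
    have : e.symm (f x) = x := e.symm_apply_apply x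
    rw [this]
    exact hgf x
  refine ⟨roeEquiv p e hf he', ?_, roeEquiv_diagonalPart e hf he'⟩
  exact Isometry.of_dist_eq fun S T => (isometry_permConj e).dist_eq (S : SeqOp p X) T

end Permutation

/-! ### Functoriality of `K₀` and divisors of the unit class -/

section KTheoryFunctoriality

variable {A B : Type*} [Ring A] [Ring B]

theorem AlgEquivalent.map {m n : Type} [Fintype m] [Fintype n] (φ : A →+* B) {e : Matrix m m A}
    {f : Matrix n n A} (h : AlgEquivalent e f) : AlgEquivalent (e.map φ) (f.map φ) := by
  obtain ⟨x, y, rfl, rfl⟩ := h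
  exact ⟨x.map φ, y.map φ, Matrix.map_mul, Matrix.map_mul⟩

/-- The image of an idempotent matrix under a ring homomorphism. -/
def IdemMatrix.map (φ : A →+* B) (e : IdemMatrix A) : IdemMatrix B where
  size := e.size
  mat := e.mat.map φ
  idem := by rw [IsIdempotentElem, ← Matrix.map_mul, e.idem.eq]

/-- Exhibiting both sides with the same literal size `n` avoids heterogeneous equality of matrices.
-/
theorem IdemMatrix.ext_mat {e f : IdemMatrix A} {n : ℕ} {M : Matrix (Fin n) (Fin n) A}
    {h : IsIdempotentElem M} {M' : Matrix (Fin n) (Fin n) A} {h' : IsIdempotentElem M'}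
    (he : e = ⟨n, M, h⟩) (hf : f = ⟨n, M', h'⟩) (hM : M = M') : e = f := by
  subst hM; rw [he, hf]

theorem IdemMatrix.map_sum (φ : A →+* B) (e f : IdemMatrix A) :
    (e.sum f).map φ = (e.map φ).sum (f.map φ) := by
  refine IdemMatrix.ext_mat rfl rfl ?_
  change ((Matrix.fromBlocks e.mat 0 0 f.mat).map φ).submatrix _ _
    = (Matrix.fromBlocks (e.mat.map φ) (0 : Matrix (Fin e.size) (Fin f.size) B) 0
        (f.mat.map φ)).submatrix _ _
  rw [Matrix.fromBlocks_map, Matrix.map_zero _ (map_zero φ), Matrix.map_zero _ (map_zero φ)]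
  rfl

theorem IdemMatrix.map_unit (φ : A →+* B) :
    (IdemMatrix.unit : IdemMatrix A).map φ = IdemMatrix.unit := by
  refine IdemMatrix.ext_mat rfl rfl ?_
  simp [IdemMatrix.unit]

theorem IdemMatrix.map_empty (φ : A →+* B) :
    (IdemMatrix.empty : IdemMatrix A).map φ = IdemMatrix.empty := by
  refine IdemMatrix.ext_mat rfl rfl ?_
  simp [IdemMatrix.empty]

theorem IdemMatrix.map_map_equiv (φ : A ≃+* B) (e : IdemMatrix A) :
    (e.map (φ : A →+* B)).map (φ.symm : B →+* A) = e := by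
  cases e
  refine IdemMatrix.ext_mat rfl rfl ?_
  ext i j
  exact φ.symm_apply_apply _

/-- A ring homomorphism induces a homomorphism between the monoids of classes of idempotents. -/
def IdemClass.map (φ : A →+* B) : IdemClass A →+ IdemClass B where
  toFun := Quotient.map (IdemMatrix.map φ) fun _ _ h => AlgEquivalent.map φ h
  map_zero' := congrArg (Quotient.mk _) (IdemMatrix.map_empty φ)
  map_add' a b := Quotient.inductionOn₂ a b fun e f =>
    congrArg (Quotient.mk _) (IdemMatrix.map_sum φ e f)

theorem IdemClass.map_symm_map (φ : A ≃+* B) (a : IdemClass A) :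
    IdemClass.map (φ.symm : B →+* A) (IdemClass.map (φ : A →+* B) a) = a :=
  Quotient.inductionOn a fun e => congrArg (Quotient.mk _) (IdemMatrix.map_map_equiv φ e)

/-- The homomorphism between `K₀` groups induced by a ring homomorphism. -/
noncomputable def KZero.map (φ : A →+* B) : KZero A →+ KZero B :=
  Algebra.GrothendieckAddGroup.lift (Algebra.GrothendieckAddGroup.of.comp (IdemClass.map φ))

theorem GrothendieckAddGroup.lift_of {M G : Type*} [AddCommMonoid M] [AddCommGroup G] (f : M →+ G)
    (a : M) : Algebra.GrothendieckAddGroup.lift f (Algebra.GrothendieckAddGroup.of a) = f a :=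
  DFunLike.congr_fun (Algebra.GrothendieckAddGroup.lift.symm_apply_apply f) a

theorem KZero.map_of (φ : A →+* B) (a : IdemClass A) :
    KZero.map φ (Algebra.GrothendieckAddGroup.of a)
      = Algebra.GrothendieckAddGroup.of (IdemClass.map φ a) :=
  GrothendieckAddGroup.lift_of _ a

theorem KZero.map_kClass (φ : A →+* B) (e : IdemMatrix A) :
    KZero.map φ (kClass e) = kClass (e.map φ) :=
  KZero.map_of φ _

/-- A homomorphism out of a Grothendieck group is determined by its values on the monoid. -/
theorem KZero.map_symm_comp_map (φ : A ≃+* B) :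
    (KZero.map (φ.symm : B →+* A)).comp (KZero.map (φ : A →+* B)) = AddMonoidHom.id _ := by
  apply Algebra.GrothendieckAddGroup.lift.symm.injective
  ext a
  change KZero.map _ (KZero.map _ (Algebra.GrothendieckAddGroup.of a))
    = Algebra.GrothendieckAddGroup.of a
  rw [KZero.map_of, KZero.map_of, IdemClass.map_symm_map]

/-- The isomorphism between `K₀` groups induced by a ring isomorphism. -/
noncomputable def KZero.mapEquiv (φ : A ≃+* B) : KZero A ≃+ KZero B :=
  (KZero.map (φ : A →+* B)).toAddEquiv (KZero.map (φ.symm : B →+* A))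
    (KZero.map_symm_comp_map φ) (KZero.map_symm_comp_map φ.symm)

theorem KZeroOrderedUnitIso.of_ringEquiv (φ : A ≃+* B) : KZeroOrderedUnitIso A B := by
  refine ⟨KZero.mapEquiv φ, ?_, ?_⟩
  · apply Set.Subset.antisymm
    · rintro _ ⟨_, ⟨e, rfl⟩, rfl⟩
      exact ⟨e.map φ, (KZero.map_kClass (φ : A →+* B) e).symm⟩
    · rintro _ ⟨f, rfl⟩
      refine ⟨_, ⟨f.map (φ.symm : B →+* A), rfl⟩, ?_⟩
      refine (KZero.map_kClass (φ : A →+* B) _).trans (congrArg kClass ?_)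
      exact IdemMatrix.map_map_equiv φ.symm f
  · exact (KZero.map_kClass (φ : A →+* B) _).trans (congrArg kClass (IdemMatrix.map_unit _))

theorem isIdempotentElem_diagonal_const {n : Type} [Fintype n] [DecidableEq n] {e : A}
    (he : IsIdempotentElem e) : IsIdempotentElem (Matrix.diagonal fun _ : n => e) := by
  rw [IsIdempotentElem, Matrix.diagonal_mul_diagonal, he.eq]

/-- The idempotent matrix `diag(e, …, e)` of size `n`. -/
def IdemMatrix.diag (n : ℕ) {e : A} (he : IsIdempotentElem e) : IdemMatrix A where
  size := n
  mat := Matrix.diagonal fun _ => e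
  idem := isIdempotentElem_diagonal_const he

theorem IdemMatrix.diag_add (m n : ℕ) {e : A} (he : IsIdempotentElem e) :
    (IdemMatrix.diag m he).sum (IdemMatrix.diag n he) = IdemMatrix.diag (m + n) he := by
  refine IdemMatrix.ext_mat rfl rfl ?_
  change (Matrix.fromBlocks (Matrix.diagonal fun _ : Fin m => e) (0 : Matrix (Fin m) (Fin n) A) 0
    (Matrix.diagonal fun _ : Fin n => e)).submatrix (finSumFinEquiv (m := m) (n := n)).symm
    (finSumFinEquiv (m := m) (n := n)).symm = _
  rw [Matrix.fromBlocks_diagonal, Matrix.submatrix_diagonal_equiv]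
  congr 1
  funext i
  simp only [Function.comp]
  rcases finSumFinEquiv.symm i with j | j <;> rfl

theorem kClass_sum (e f : IdemMatrix A) : kClass (e.sum f) = kClass e + kClass f :=
  let mk : IdemMatrix A → IdemClass A := Quotient.mk _
  (Algebra.GrothendieckAddGroup.of (M := IdemClass A)).map_add (mk e) (mk f)

theorem kClass_eq_of_algEquivalent {e f : IdemMatrix A} (h : AlgEquivalent e.mat f.mat) :
    kClass e = kClass f :=
  congrArg Algebra.GrothendieckAddGroup.of (Quotient.sound h : (Quotient.mk _ e : IdemClass A) = _)

theorem kClass_diag (n : ℕ) {e : A} (he : IsIdempotentElem e) :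
    kClass (IdemMatrix.diag n he) = n • kClass (IdemMatrix.diag 1 he) := by
  induction n with
  | zero =>
    rw [zero_smul, ← map_zero (Algebra.GrothendieckAddGroup.of (M := IdemClass A))]
    refine kClass_eq_of_algEquivalent (f := IdemMatrix.empty) ?_
    refine ⟨0, 0, ?_, ?_⟩ <;> ext i <;> exact i.elim0
  | succ n ih => rw [← IdemMatrix.diag_add, kClass_sum, ih, succ_nsmul]

/-- If the unit of `A` is a sum of `n` idempotents which are equivalent to an idempotent `e` and
mutually orthogonal, then the class of the unit is divisible by `n`. -/
theorem exists_nsmul_eq_kUnit {ι : Type} [Fintype ι] [DecidableEq ι] {e : A} (x y : ι → A)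
    (he : IsIdempotentElem e) (hsum : ∑ i, x i * y i = 1)
    (horth : ∀ i j, y i * x j = if i = j then e else 0) :
    ∃ a : KZero A, Fintype.card ι • a = kUnit A := by
  refine ⟨kClass (IdemMatrix.diag 1 he), ?_⟩
  rw [← kClass_diag]
  refine kClass_eq_of_algEquivalent ?_
  -- The row of the `x i` times the column of the `y i` is the unit; in the other order the product
  -- is `diag(e, …, e)`.
  have h1 : AlgEquivalent (1 : Matrix (Fin 1) (Fin 1) A) (Matrix.diagonal fun _ : ι => e) := by
    refine ⟨Matrix.of fun _ i => x i, Matrix.of fun i _ => y i, ?_, ?_⟩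
    · ext i j
      rw [Subsingleton.elim i j]
      simpa [Matrix.mul_apply] using hsum.symm
    · ext i j
      simp [Matrix.mul_apply, horth, Matrix.diagonal_apply]
  have h2 := AlgEquivalent.reindex (isIdempotentElem_diagonal_const (n := ι) he)
    (Fintype.equivFin ι)
  rw [Matrix.submatrix_diagonal_equiv] at h2
  exact (h1.trans IsIdempotentElem.one (IdemMatrix.diag _ he).idem h2).symm

end KTheoryFunctoriality

/-! ### Finite subgroups give divisors of the unit class -/

section Divisors

variable {p : ℝ≥0} [Fact (1 ≤ (p : ℝ≥0∞))] {X : Type*}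

/-- Multiplication by the indicator function of a set. -/
noncomputable def indicatorOp (p : ℝ≥0) [Fact (1 ≤ (p : ℝ≥0∞))] (E : Set X) : SeqOp p X :=
  mulOp p ⟨E.indicator 1, memℓp_infty ⟨1, by
    rintro _ ⟨x, rfl⟩
    by_cases h : x ∈ E <;> simp [h]⟩⟩

/-- The operator permuting the coordinates by a bijection. -/
noncomputable def permOp (p : ℝ≥0) [Fact (1 ≤ (p : ℝ≥0∞))] (e : X ≃ X) : SeqOp p X :=
  (permIsometry p e).toContinuousLinearEquiv

theorem permOp_apply (e : X ≃ X) (ξ : SeqSpace p X) (x : X) :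
    permOp p e ξ x = ξ (e.symm x) := rfl

theorem coeff_permOp_ne_zero {e : X ≃ X} {x y : X} (h : coeff (permOp p e) x y ≠ 0) : x = e y := by
  classical
  by_contra hne
  apply h
  unfold coeff
  rw [permOp_apply, lp.single_apply_ne]
  rintro rfl
  exact hne (e.apply_symm_apply x).symm

theorem indicatorOp_mem_uniformRoe [MetricSpace X] (E : Set X) :
    indicatorOp p E ∈ uniformRoe p X :=
  mulOp_mem_uniformRoe p _

theorem permOp_mem_uniformRoe [MetricSpace X] (e : X ≃ X) {R : ℝ} (he : ∀ x, dist (e x) x ≤ R) :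
    permOp p e ∈ uniformRoe p X := by
  refine Subalgebra.le_topologicalClosure _ (mem_finitePropagation_iff.2
    ⟨max R 1, by positivity, fun x y h => le_max_of_le_left ?_⟩)
  rw [coeff_permOp_ne_zero h]
  exact he y

/-- `E` picks one point from each left coset, so its right translates by `H` partition the group. -/
theorem Subgroup.exists_left_transversal {G : Type*} [Group G] (H : Subgroup G) :
    ∃ E : Set G, ∀ x : G, ∃! h : H, x * h ∈ E := by
  refine ⟨Set.range (Quotient.out : G ⧸ H → G), fun x => ?_⟩
  have h1 : x⁻¹ * (x : G ⧸ H).out ∈ H := by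
    rw [← QuotientGroup.eq]
    exact (Quotient.out_eq (x : G ⧸ H)).symm
  refine ⟨⟨_, h1⟩, ⟨(x : G ⧸ H), by simp⟩, ?_⟩
  rintro ⟨k, hk⟩ ⟨q, hq⟩
  have h2 : q = (x : G ⧸ H) := by
    rw [← Quotient.out_eq q]
    change ((q.out : G) : G ⧸ H) = x
    rw [hq]
    exact QuotientGroup.mk_mul_of_mem x hk
  apply Subtype.ext
  simp only at hq ⊢
  rw [← h2, hq, inv_mul_cancel_left]

variable {G : Type*} [Group G] [MetricSpace G] [IsIsometricSMul G G]

/-- The order of a finite subgroup divides the class of the unit of the uniform Roe algebra. -/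
theorem exists_card_nsmul_eq_kUnit (H : Subgroup G) [Finite H] :
    ∃ a : KZero (uniformRoe p G), Nat.card H • a = kUnit (uniformRoe p G) := by
  classical
  obtain ⟨E, hE⟩ := H.exists_left_transversal
  let σ : Fin (Nat.card H) ≃ H := (Finite.equivFin H).symm
  -- Left invariance gives `d(xg, x) = d(g, 1)`: right translations have finite propagation.
  have hperm : ∀ g : G, permOp p (Equiv.mulRight g) ∈ uniformRoe p G := fun g => by
    refine permOp_mem_uniformRoe (R := dist g 1) _ fun x => ?_
    rw [← dist_smul x⁻¹]
    simp
  let e : uniformRoe p G := ⟨indicatorOp p E, indicatorOp_mem_uniformRoe E⟩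
  let r : G → uniformRoe p G := fun g => ⟨permOp p (Equiv.mulRight g), hperm g⟩
  have happ : ∀ (g : G) (T : uniformRoe p G) (ξ : SeqSpace p G) (z : G),
      ((r g * T : uniformRoe p G) : SeqOp p G) ξ z = (T : SeqOp p G) ξ (z * g⁻¹) :=
    fun _ _ _ _ => rfl
  have hrapp : ∀ (g : G) (ξ : SeqSpace p G) (z : G),
      ((r g : uniformRoe p G) : SeqOp p G) ξ z = ξ (z * g⁻¹) := fun _ _ _ => rfl
  have heapp : ∀ (T : uniformRoe p G) (ξ : SeqSpace p G) (z : G),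
      ((e * T : uniformRoe p G) : SeqOp p G) ξ z = E.indicator 1 z * (T : SeqOp p G) ξ z :=
    fun _ _ _ => rfl
  have heapp' : ∀ (ξ : SeqSpace p G) (z : G),
      ((e : uniformRoe p G) : SeqOp p G) ξ z = E.indicator 1 z * ξ z :=
    fun _ _ => rfl
  have hee : IsIdempotentElem e := by
    refine Subtype.ext (ContinuousLinearMap.ext fun ξ => lp.ext (funext fun z => ?_))
    rw [heapp, heapp']
    by_cases hz : z ∈ E <;> simp [hz]
  -- For `h = σ i`, the product of the two factors is multiplication by the indicator of `E h⁻¹`,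
  -- and these sets partition the group. In the other order, the product for `i ≠ j` vanishes
  -- because `E` meets each coset once.
  have key := exists_nsmul_eq_kUnit (A := uniformRoe p G) (e := e)
    (fun i => r (σ i : G)⁻¹ * e) (fun i => e * r (σ i : G)) hee ?_ ?_
  · simpa using key
  · refine Subtype.ext (ContinuousLinearMap.ext fun ξ => lp.ext (funext fun z => ?_))
    have h1 : ∀ i, ((r (σ i : G)⁻¹ * e * (e * r (σ i : G)) : uniformRoe p G) : SeqOp p G) ξ z
        = E.indicator 1 (z * σ i) * ξ z := by
      intro i
      rw [mul_assoc, happ, heapp, heapp, hrapp]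
      by_cases hz : z * (σ i : G) ∈ E <;> simp [hz]
    rw [AddSubmonoidClass.coe_finsetSum, sum_apply, lp.coeFn_sum,
      Finset.sum_apply, Finset.sum_congr rfl fun i _ => h1 i, ← Finset.sum_mul]
    obtain ⟨h, hh, huniq⟩ := hE z
    rw [Finset.sum_eq_single (σ.symm h)]
    · simp [hh]
    · intro i _ hi
      refine Set.indicator_of_notMem (fun hz => hi ?_) _
      rw [← huniq (σ i) hz, σ.symm_apply_apply]
    · simp
  · intro i j
    refine Subtype.ext (ContinuousLinearMap.ext fun ξ => lp.ext (funext fun z => ?_))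
    by_cases hij : i = j
    · subst hij
      rw [mul_assoc, heapp, happ, happ, heapp', if_pos rfl, heapp']
      by_cases hz : z ∈ E <;> simp [hz]
    · rw [if_neg hij, mul_assoc, heapp, happ, happ, heapp']
      change _ = (0 : ℂ)
      by_cases hz : z ∈ E
      · have hz' : z * (σ i : G)⁻¹ * (σ j : G) ∉ E := fun h => by
          obtain ⟨k, hk, huniq⟩ := hE z
          have h2 := huniq 1 (by simpa using hz)
          have h3 := huniq ((σ i)⁻¹ * σ j) (by simpa [mul_assoc] using h)
          rw [← h2, inv_mul_eq_one] at h3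
          exact hij (σ.injective h3)
        simp [hz']
      · simp [hz]

end Divisors

/-! ### Perturbation of idempotents in Banach algebras -/

section Perturbation

variable {R : Type*} [NormedRing R] [CompleteSpace R]

/-- An element close to an idempotent `g` has `g` as a two-sided multiple. -/
theorem IsIdempotentElem.exists_eq_mul_mul {g b : R} (hg : IsIdempotentElem g) (h : ‖g - b‖ < 1) :
    ∃ u, g = u * b * g := by
  -- The element `1 - (g - b)` is invertible by the Neumann series and agrees with `b` after right
  -- multiplication by `g`.
  refine ⟨↑(Units.oneSub (g - b) h)⁻¹, ?_⟩
  have h1 : (1 - (g - b)) * g = b * g := by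
    rw [sub_mul, one_mul, sub_mul, hg.eq]
    abel
  rw [mul_assoc, ← h1, ← Units.val_oneSub (g - b) h, Units.inv_mul_cancel_left]

/-- An almost idempotent element of a Banach ring is close to an idempotent. -/
theorem exists_isIdempotentElem_norm_sub_le {K δ : ℝ} {a : R} (hδ : δ ≤ 1 / 8)
    (hK : ‖1 - 2 * a‖ ≤ K) (ha : ‖a * a - a‖ ≤ δ) :
    ∃ f : R, IsIdempotentElem f ∧ ‖f - a‖ ≤ 3 * K * δ := by
  -- Newton's iteration for `x² = x`, with the inverse of `2x - 1` replaced by `2x - 1` itself,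
  -- since `(2x - 1)² = 1 + 4(x² - x)` is near 1.
  let u : ℕ → R := fun n => Nat.rec a (fun _ x => x + (1 - 2 * x) * (x * x - x)) n
  have hu : ∀ n, u (n + 1) = u n + (1 - 2 * u n) * (u n * u n - u n) := fun n => rfl
  have hK0 : 0 ≤ K := (norm_nonneg _).trans hK
  have hδ0 : 0 ≤ δ := (norm_nonneg _).trans ha
  have hz : ∀ n, ‖u n * u n - u n‖ ≤ δ * (1 / 2) ^ n := by
    intro n
    induction n with
    | zero => rw [pow_zero, mul_one]; exact ha
    | succ n ih =>
      set z := u n * u n - u n with hzdef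
      have hle : ‖z‖ ≤ 1 / 8 := by
        refine ih.trans ((mul_le_of_le_one_right hδ0 ?_).trans hδ)
        exact pow_le_one₀ (by norm_num) (by norm_num)
      -- With `‖z‖ ≤ 1/8` the new defect is at most `(4/64 + 3/8)‖z‖ = (7/16)‖z‖`, below half the
      -- old one.
      have e1 : u (n + 1) * u (n + 1) - u (n + 1) = 4 • (z * z * z) - 3 • (z * z) := by
        rw [hu, hzdef]
        noncomm_ring
      have hzz : ‖z * z‖ ≤ ‖z‖ * (1 / 8) :=
        (norm_mul_le _ _).trans (mul_le_mul_of_nonneg_left hle (norm_nonneg _))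
      have hzzz : ‖z * z * z‖ ≤ ‖z * z‖ * (1 / 8) :=
        (norm_mul_le _ _).trans (mul_le_mul_of_nonneg_left hle (norm_nonneg _))
      have h4 : ‖4 • (z * z * z)‖ ≤ 4 * ‖z * z * z‖ := by
        simpa using norm_nsmul_le (n := 4) (a := z * z * z)
      have h3 : ‖3 • (z * z)‖ ≤ 3 * ‖z * z‖ := by
        simpa using norm_nsmul_le (n := 3) (a := z * z)
      rw [e1, pow_succ]
      have := norm_sub_le (4 • (z * z * z)) (3 • (z * z))
      nlinarith [norm_nonneg z]
  have hs : ∀ n, ‖1 - 2 * u n‖ ≤ K * (5 / 4) ^ n := by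
    intro n
    induction n with
    | zero => rw [pow_zero, mul_one]; exact hK
    | succ n ih =>
      set z := u n * u n - u n with hzdef
      have hle : ‖z‖ ≤ 1 / 8 := by
        refine (hz n).trans ((mul_le_of_le_one_right hδ0 ?_).trans hδ)
        exact pow_le_one₀ (by norm_num) (by norm_num)
      have e1 : 1 - 2 * u (n + 1) = (1 - 2 * u n) - 2 • ((1 - 2 * u n) * z) := by
        rw [hu, hzdef]
        noncomm_ring
      have h2 : ‖2 • ((1 - 2 * u n) * z)‖ ≤ 2 * ‖(1 - 2 * u n) * z‖ := by
        simpa using norm_nsmul_le (n := 2) (a := (1 - 2 * u n) * z)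
      have h3 : ‖(1 - 2 * u n) * z‖ ≤ ‖1 - 2 * u n‖ * (1 / 8) :=
        (norm_mul_le _ _).trans (mul_le_mul_of_nonneg_left hle (norm_nonneg _))
      rw [e1, pow_succ]
      have := norm_sub_le (1 - 2 * u n) (2 • ((1 - 2 * u n) * z))
      nlinarith
  -- The ratio is `(5/4)(1/2) = 5/8`; the geometric series sums to `8/3`, which the constant 3 in
  -- the conclusion absorbs.
  have hd : ∀ n, dist (u n) (u (n + 1)) ≤ K * δ * (5 / 8) ^ n := by
    intro n
    rw [dist_comm, dist_eq_norm, hu, add_sub_cancel_left]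
    refine (norm_mul_le _ _).trans ((mul_le_mul (hs n) (hz n) (norm_nonneg _)
      (by positivity)).trans_eq ?_)
    rw [mul_mul_mul_comm, ← mul_pow]
    norm_num
  obtain ⟨f, hf⟩ := cauchySeq_tendsto_of_complete
    (cauchySeq_of_le_geometric (5 / 8) (K * δ) (by norm_num) hd)
  refine ⟨f, ?_, ?_⟩
  · have h1 : Filter.Tendsto (fun n => u n * u n - u n) Filter.atTop (nhds (f * f - f)) :=
      (hf.mul hf).sub hf
    have h2 : Filter.Tendsto (fun n => u n * u n - u n) Filter.atTop (nhds 0) := by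
      refine squeeze_zero_norm hz ?_
      simpa using (tendsto_pow_atTop_nhds_zero_of_lt_one (r := (1 / 2 : ℝ)) (by norm_num)
        (by norm_num)).const_mul δ
    exact sub_eq_zero.1 (tendsto_nhds_unique h1 h2)
  · have := dist_le_of_le_geometric_of_tendsto₀ (5 / 8) (K * δ) (by norm_num) hd hf
    rw [← dist_eq_norm, dist_comm]
    refine this.trans ?_
    have : 0 ≤ K * δ := by positivity
    norm_num
    linarith

end Perturbation

/-! ### Ranks of matrices over algebras represented on finite-dimensional spaces -/

section Rank

theorem Matrix.rank_eq_trace_of_isIdempotentElem {n : Type*} [Fintype n] [DecidableEq n]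
    {M : Matrix n n ℂ} (hM : IsIdempotentElem M) : (M.rank : ℂ) = M.trace := by
  have h : IsIdempotentElem (Matrix.toLin' M) := by
    rw [IsIdempotentElem, Module.End.mul_eq_comp, ← Matrix.toLin'_mul, hM.eq]
  have h1 := (LinearMap.IsIdempotentElem.isProj_range _ h).trace
  rw [Matrix.trace_toLin'_eq] at h1
  rw [h1]
  rfl

variable {S : Type*} [Ring S] {ι : Type*} [Fintype ι] [DecidableEq ι] (ρ : S →+* Matrix ι ι ℂ)
variable {l m n : Type*} [Fintype m]

/-- The rank of the complex matrix obtained by applying a matrix representation to the entries of a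
matrix. -/
noncomputable def repRank [Fintype n] (M : Matrix m n S) : ℕ :=
  (Matrix.comp m n ι ι ℂ (M.map ρ)).rank

theorem comp_map_mul (M : Matrix l m S) (N : Matrix m n S) :
    Matrix.comp l n ι ι ℂ ((M * N).map ρ)
      = Matrix.comp l m ι ι ℂ (M.map ρ) * Matrix.comp m n ι ι ℂ (N.map ρ) := by
  rw [Matrix.map_mul]
  ext ⟨i, a⟩ ⟨j, b⟩
  simp [Matrix.comp_apply, Matrix.mul_apply, Fintype.sum_prod_type, Matrix.sum_apply]

variable [Fintype n]

theorem repRank_mul_le_left (M : Matrix l m S) (N : Matrix m n S) :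
    repRank ρ (M * N) ≤ repRank ρ M := by
  rw [repRank, comp_map_mul]
  exact Matrix.rank_mul_le_left _ _

theorem repRank_mul_le_right (M : Matrix l m S) (N : Matrix m n S) :
    repRank ρ (M * N) ≤ repRank ρ N := by
  rw [repRank, comp_map_mul]
  exact Matrix.rank_mul_le_right _ _

/-- For idempotents rank is trace, which is linear and sees only diagonal entries. This yields
additivity on block sums and the value on the unit. -/
theorem repRank_eq_trace [DecidableEq m] {M : Matrix m m S} (hM : IsIdempotentElem M) :
    (repRank ρ M : ℂ) = (ρ M.trace).trace := by
  have h : IsIdempotentElem (Matrix.comp m m ι ι ℂ (M.map ρ)) := by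
    rw [IsIdempotentElem, ← comp_map_mul, hM.eq]
  rw [repRank, Matrix.rank_eq_trace_of_isIdempotentElem h]
  simp only [Matrix.trace, Matrix.diag, Fintype.sum_prod_type, Matrix.comp_apply, map_sum,
    Matrix.sum_apply, Matrix.map_apply]
  exact Finset.sum_comm

end Rank

/-! ### The rank homomorphism of an approximately finite-dimensional Banach algebra -/

section MatrixNorm

open scoped Matrix.Norms.Operator

variable {R : Type*} [NormedRing R] {m n : Type*} [Fintype m] [Fintype n]

theorem Matrix.completeSpace_linfty_opNorm [CompleteSpace R] [DecidableEq n] :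
    @CompleteSpace (Matrix n n R) Matrix.linftyOpNormedRing.toPseudoMetricSpace.toUniformSpace :=
  Matrix.instCompleteSpace _ _ _

theorem Matrix.linfty_opNorm_map_subtype (S : Subring R) (M : Matrix m n S) :
    ‖M.map S.subtype‖ = ‖M‖ := by
  rw [Matrix.linfty_opNorm_def, Matrix.linfty_opNorm_def]
  rfl

theorem Matrix.linfty_opNorm_lt_iff {M : Matrix m n R} {ε : ℝ} (hε : 0 < ε) :
    ‖M‖ < ε ↔ ∀ i, ∑ j, ‖M i j‖ < ε := by
  lift ε to ℝ≥0 using hε.le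
  rw [Matrix.linfty_opNorm_def, NNReal.coe_lt_coe, Finset.sup_lt_iff (by exact_mod_cast hε)]
  simp [← NNReal.coe_lt_coe]

theorem Matrix.linfty_opNorm_blockSum_lt {m n : Type*} [Fintype m] [Fintype n] {k : Type*}
    [Fintype k] (σ : k ≃ m ⊕ n) {M : Matrix m m R} {N : Matrix n n R} {ε : ℝ} (hε : 0 < ε)
    (hM : ‖M‖ < ε) (hN : ‖N‖ < ε) : ‖(Matrix.fromBlocks M 0 0 N).submatrix σ σ‖ < ε := by
  rw [Matrix.linfty_opNorm_lt_iff hε] at *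
  intro i
  rw [← σ.symm.sum_comp]
  rcases h : σ i with j | j
  · simpa [h] using hM j
  · simpa [h] using hN j

end MatrixNorm

-- Ranks along a matricial approximation and their germs at infinity.

section RankHom

open Filter Topology
open scoped Matrix.Norms.Operator

variable {A : Type*} [NormedRing A] {ι : ℕ → Type*} [∀ k, Fintype (ι k)] [∀ k, DecidableEq (ι k)]

variable (A ι) in
/-- A family of closed subrings of `A` in which every element of `A` can eventually be
approximated, each represented by complex matrices. -/
structure MatricialApproximation where
  /-- The approximating subrings. -/
  sub : ℕ → Subring A
  isClosed : ∀ k, IsClosed (sub k : Set A)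
  dense : ∀ (a : A) (ε : ℝ), 0 < ε → ∀ᶠ k in atTop, ∃ s ∈ sub k, ‖s - a‖ < ε
  /-- The matrix representations. -/
  rep : ∀ k, sub k →+* Matrix (ι k) (ι k) ℂ

namespace MatricialApproximation

instance (𝒮 : MatricialApproximation A ι) [CompleteSpace A] (k : ℕ) : CompleteSpace (𝒮.sub k) :=
  (𝒮.isClosed k).completeSpace_coe

variable (𝒮 : MatricialApproximation A ι) {m n : Type*} [Fintype m] [Fintype n]

theorem eventually_exists_matrix (M : Matrix m n A) {ε : ℝ} (hε : 0 < ε) :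
    ∀ᶠ k in atTop, ∃ N : Matrix m n (𝒮.sub k), ‖N.map (𝒮.sub k).subtype - M‖ < ε := by
  -- The norm is the largest row sum, and a row has `Fintype.card n` entries; the extra 1 keeps the
  -- bound strict and covers empty rows.
  set η := ε / (Fintype.card n + 1)
  have hη : 0 < η := by positivity
  have h : ∀ᶠ k in atTop, ∀ i j, ∃ s ∈ 𝒮.sub k, ‖s - M i j‖ < η := by
    rw [eventually_all]
    intro i
    rw [eventually_all]
    intro j
    exact 𝒮.dense (M i j) η hη
  filter_upwards [h] with k hk
  choose s hs hsM using hk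
  refine ⟨Matrix.of fun i j => ⟨s i j, hs i j⟩, ?_⟩
  rw [Matrix.linfty_opNorm_lt_iff hε]
  intro i
  calc ∑ j, ‖((Matrix.of fun i j => (⟨s i j, hs i j⟩ : 𝒮.sub k)).map (𝒮.sub k).subtype - M) i j‖
      ≤ ∑ _j : n, η := Finset.sum_le_sum fun j _ => (hsM i j).le
    _ = Fintype.card n * η := by simp
    _ < (Fintype.card n + 1) * η := by linarith
    _ = ε := mul_div_cancel₀ _ (by positivity)

/-- `f` is an idempotent matrix over the `k`-th subring approximating the matrix `e`. -/
def IsNear (k : ℕ) (e : Matrix n n A) (f : Matrix n n (𝒮.sub k)) : Prop :=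
  IsIdempotentElem f ∧ ‖f.map (𝒮.sub k).subtype - e‖ < 1 / 2

-- The idempotent `f` factors through `b` by `IsIdempotentElem.exists_eq_mul_mul`, applied over the
-- subring, which is complete because it is closed. Applied both ways, this shows that two nearby
-- idempotents have equal rank.
variable {𝒮} in
theorem repRank_le_of_norm_sub_lt_one [CompleteSpace A] [DecidableEq n] {k : ℕ}
    {f b : Matrix n n (𝒮.sub k)}
    (hf : IsIdempotentElem f) (h : ‖f - b‖ < 1) :
    repRank (𝒮.rep k) f ≤ repRank (𝒮.rep k) b := by
  have := Matrix.completeSpace_linfty_opNorm (R := 𝒮.sub k) (n := n)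
  obtain ⟨u, hu⟩ := hf.exists_eq_mul_mul h
  calc repRank (𝒮.rep k) f = repRank (𝒮.rep k) (u * b * f) := by rw [← hu]
    _ ≤ repRank (𝒮.rep k) (u * b) := repRank_mul_le_left _ _ _
    _ ≤ repRank (𝒮.rep k) b := repRank_mul_le_right _ _ _

variable {𝒮} in
theorem norm_sub_lt_one {k : ℕ} {e : Matrix m n A} {f b : Matrix m n (𝒮.sub k)}
    (hf : ‖f.map (𝒮.sub k).subtype - e‖ < 1 / 2) (hb : ‖b.map (𝒮.sub k).subtype - e‖ < 1 / 2) :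
    ‖f - b‖ < 1 := by
  rw [← Matrix.linfty_opNorm_map_subtype, Matrix.map_sub _ (map_sub _),
    ← sub_sub_sub_cancel_right _ _ e]
  refine (norm_sub_le _ _).trans_lt ?_
  linarith

variable {𝒮} in
theorem IsNear.repRank_eq [CompleteSpace A] [DecidableEq n] {k : ℕ} {e : Matrix n n A}
    {f f' : Matrix n n (𝒮.sub k)}
    (h : 𝒮.IsNear k e f) (h' : 𝒮.IsNear k e f') :
    repRank (𝒮.rep k) f = repRank (𝒮.rep k) f' :=
  le_antisymm (repRank_le_of_norm_sub_lt_one h.1 (norm_sub_lt_one h.2 h'.2))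
    (repRank_le_of_norm_sub_lt_one h'.1 (norm_sub_lt_one h'.2 h.2))

/-- A matrix over the subring close to `e` is almost idempotent, and the Newton iteration corrects
it without leaving the closed subring. -/
theorem eventually_exists_isIdempotentElem [CompleteSpace A] [DecidableEq n] {e : Matrix n n A}
    (he : IsIdempotentElem e) {ε : ℝ} (hε : 0 < ε) :
    ∀ᶠ k in atTop, ∃ f : Matrix n n (𝒮.sub k), IsIdempotentElem f ∧
      ‖f.map (𝒮.sub k).subtype - e‖ < ε := by
  set K := ‖1 - 2 * e‖ + 1
  have hK : 0 < K := by positivity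
  -- Chosen so that the correction `3 * K * δ` costs at most `ε / 2`; the other half is spent on
  -- approximating `e`.
  set δ := min (1 / 8) (ε / (2 * (3 * K)))
  have hδ : 0 < δ := by positivity
  have h1 : ∀ᶠ a in 𝓝 e, ‖1 - 2 * a‖ < K :=
    (continuous_const.sub (continuous_const.mul continuous_id)).norm.continuousAt.eventually_lt
      continuousAt_const (by simp [K])
  have h2 : ∀ᶠ a in 𝓝 e, ‖a * a - a‖ < δ :=
    ((continuous_id.mul continuous_id).sub continuous_id).norm.continuousAt.eventually_lt
      continuousAt_const (by simpa [he.eq] using hδ)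
  obtain ⟨η, hη, hball⟩ := Metric.eventually_nhds_iff.1 (h1.and h2)
  filter_upwards [𝒮.eventually_exists_matrix e (lt_min hη (half_pos hε))] with k ⟨a, ha⟩
  obtain ⟨h3, h4⟩ := hball (y := a.map (𝒮.sub k).subtype)
    (by rw [dist_eq_norm]; exact ha.trans_le (min_le_left _ _))
  have e1 : (1 - 2 * a).map (𝒮.sub k).subtype = 1 - 2 * a.map (𝒮.sub k).subtype := by
    change (𝒮.sub k).subtype.mapMatrix (1 - 2 * a) = 1 - 2 * (𝒮.sub k).subtype.mapMatrix a
    rw [map_sub, map_mul, map_one, map_ofNat]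
  have e2 : (a * a - a).map (𝒮.sub k).subtype
      = a.map (𝒮.sub k).subtype * a.map (𝒮.sub k).subtype - a.map (𝒮.sub k).subtype := by
    rw [Matrix.map_sub _ (map_sub _), Matrix.map_mul]
  rw [← e1, Matrix.linfty_opNorm_map_subtype] at h3
  rw [← e2, Matrix.linfty_opNorm_map_subtype] at h4
  have := Matrix.completeSpace_linfty_opNorm (R := 𝒮.sub k) (n := n)
  obtain ⟨f, hf, hfa⟩ := exists_isIdempotentElem_norm_sub_le (min_le_left _ _) h3.le h4.le
  refine ⟨f, hf, ?_⟩
  rw [← Matrix.linfty_opNorm_map_subtype, Matrix.map_sub _ (map_sub _)] at hfa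
  have h5 : 3 * K * δ ≤ ε / 2 := by
    calc 3 * K * δ ≤ 3 * K * (ε / (2 * (3 * K))) := by gcongr; exact min_le_right _ _
      _ = ε / 2 := by field_simp
  calc ‖f.map (𝒮.sub k).subtype - e‖
      ≤ ‖f.map (𝒮.sub k).subtype - a.map (𝒮.sub k).subtype‖
        + ‖a.map (𝒮.sub k).subtype - e‖ := norm_sub_le_norm_sub_add_norm_sub _ _ _
    _ < ε / 2 + ε / 2 :=
        add_lt_add_of_le_of_lt (hfa.trans h5) (ha.trans_le (min_le_right _ _))
    _ = ε := add_halves ε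

open Classical in
/-- The rank of an idempotent matrix `e` at stage `k`: the rank of the representation of any
idempotent matrix over the `k`-th subring which is close to `e`. -/
noncomputable def idemRank (k : ℕ) (e : IdemMatrix A) : ℕ :=
  -- The default 0 is harmless: for each `e` it can occur only at finitely many stages.
  if h : ∃ f, 𝒮.IsNear k e.mat f then repRank (𝒮.rep k) h.choose else 0

variable {𝒮} in
theorem IsNear.idemRank_eq [CompleteSpace A] {k : ℕ} {e : IdemMatrix A}
    {f : Matrix (Fin e.size) (Fin e.size) (𝒮.sub k)} (h : 𝒮.IsNear k e.mat f) :
    𝒮.idemRank k e = repRank (𝒮.rep k) f := by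
  have hex : ∃ f, 𝒮.IsNear k e.mat f := ⟨f, h⟩
  rw [idemRank, dif_pos hex]
  exact hex.choose_spec.repRank_eq h

/-- Writing `e = x e' y` and approximating all three factors over the subring shows that an
approximant of `e` factors through one of `e'`. Symmetry gives equality, but only beyond a stage
depending on the matrices; hence the use of germs. -/
theorem eventually_idemRank_le [CompleteSpace A] {e e' : IdemMatrix A}
    (h : AlgEquivalent e.mat e'.mat) :
    ∀ᶠ k in atTop, 𝒮.idemRank k e ≤ 𝒮.idemRank k e' := by
  obtain ⟨x, y, hxy, hyx⟩ := h
  have hprod : x * e'.mat * y = e.mat := by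
    rw [hyx, ← e.idem.eq, hxy]
    simp only [Matrix.mul_assoc]
  have hcont : ∀ᶠ q in 𝓝 (x, e'.mat, y), ‖q.1 * q.2.1 * q.2.2 - e.mat‖ < 1 / 2 := by
    refine ContinuousAt.eventually_lt (Continuous.continuousAt ?_) continuousAt_const ?_
    · fun_prop
    · simp [hprod]
  obtain ⟨η, hη, hball⟩ := Metric.eventually_nhds_iff.1 hcont
  filter_upwards [𝒮.eventually_exists_isIdempotentElem e.idem (one_half_pos (α := ℝ)),
    𝒮.eventually_exists_isIdempotentElem e'.idem (lt_min hη (one_half_pos (α := ℝ))),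
    𝒮.eventually_exists_matrix x hη, 𝒮.eventually_exists_matrix y hη]
    with k ⟨f, hf, hfe⟩ ⟨f', hf', hfe'⟩ ⟨x', hx'⟩ ⟨y', hy'⟩
  have hnear : 𝒮.IsNear k e.mat f := ⟨hf, hfe⟩
  have hnear' : 𝒮.IsNear k e'.mat f' := ⟨hf', hfe'.trans_le (min_le_right _ _)⟩
  rw [hnear.idemRank_eq, hnear'.idemRank_eq]
  have hb := hball (y := (x'.map (𝒮.sub k).subtype, f'.map (𝒮.sub k).subtype,
    y'.map (𝒮.sub k).subtype)) (by
      simp only [dist_eq_norm]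
      exact max_lt hx' (max_lt (hfe'.trans_le (min_le_left _ _)) hy'))
  simp only [← Matrix.map_mul] at hb
  calc repRank (𝒮.rep k) f ≤ repRank (𝒮.rep k) (x' * f' * y') :=
        repRank_le_of_norm_sub_lt_one hf (norm_sub_lt_one hfe hb)
    _ ≤ repRank (𝒮.rep k) (x' * f') := repRank_mul_le_left _ _ _
    _ ≤ repRank (𝒮.rep k) f' := repRank_mul_le_right _ _ _

theorem eventually_idemRank_sum [CompleteSpace A] (e e' : IdemMatrix A) :
    ∀ᶠ k in atTop, 𝒮.idemRank k (e.sum e') = 𝒮.idemRank k e + 𝒮.idemRank k e' := by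
  filter_upwards [𝒮.eventually_exists_isIdempotentElem e.idem (one_half_pos (α := ℝ)),
    𝒮.eventually_exists_isIdempotentElem e'.idem (one_half_pos (α := ℝ))]
    with k ⟨f, hf, hfe⟩ ⟨f', hf', hfe'⟩
  let σ := (finSumFinEquiv (m := e.size) (n := e'.size)).symm
  have hidem : IsIdempotentElem ((Matrix.fromBlocks f 0 0 f').submatrix σ σ) := by
    rw [IsIdempotentElem, Matrix.submatrix_mul_equiv, Matrix.fromBlocks_multiply]
    simp [hf.eq, hf'.eq]
  have hnorm : ‖((Matrix.fromBlocks f 0 0 f').submatrix σ σ).map (𝒮.sub k).subtype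
      - (Matrix.fromBlocks e.mat 0 0 e'.mat).submatrix σ σ‖ < 1 / 2 := by
    have := Matrix.linfty_opNorm_blockSum_lt σ one_half_pos hfe hfe'
    refine lt_of_eq_of_lt (congrArg norm ?_) this
    ext i j
    simp only [Matrix.sub_apply, Matrix.map_apply, Matrix.submatrix_apply]
    rcases σ i with i | i <;> rcases σ j with j | j <;> simp
  have hnear : 𝒮.IsNear k (e.sum e').mat ((Matrix.fromBlocks f 0 0 f').submatrix σ σ) :=
    ⟨hidem, hnorm⟩
  rw [hnear.idemRank_eq, IsNear.idemRank_eq ⟨hf, hfe⟩, IsNear.idemRank_eq ⟨hf', hfe'⟩,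
    ← Nat.cast_inj (R := ℂ), Nat.cast_add]
  refine (repRank_eq_trace _ hidem).trans ?_
  rw [repRank_eq_trace _ hf, repRank_eq_trace _ hf', ← Matrix.trace_add, ← map_add]
  congr 2
  refine (σ.sum_comp fun i => (Matrix.fromBlocks f 0 0 f') i i).trans ?_
  rw [Fintype.sum_sum_type]
  rfl

/-- The unit lies in every subring and approximates itself exactly, and its rank is the size of the
representation. -/
theorem idemRank_unit [CompleteSpace A] (k : ℕ) :
    𝒮.idemRank k IdemMatrix.unit = Fintype.card (ι k) := by
  have h : ‖(1 : Matrix (Fin 1) (Fin 1) (𝒮.sub k)).map (𝒮.sub k).subtype - 1‖ < 1 / 2 := by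
    rw [Matrix.map_one _ (map_zero _) (map_one _), sub_self, norm_zero]
    exact one_half_pos
  have hnear : 𝒮.IsNear k (IdemMatrix.unit : IdemMatrix A).mat
    (1 : Matrix (Fin 1) (Fin 1) (𝒮.sub k)) := ⟨IsIdempotentElem.one, h⟩
  rw [hnear.idemRank_eq, ← Nat.cast_inj (R := ℂ)]
  refine (repRank_eq_trace _ IsIdempotentElem.one).trans ?_
  change ((𝒮.rep k) (Matrix.trace (1 : Matrix (Fin 1) (Fin 1) (𝒮.sub k)))).trace = _
  simp

theorem idemRank_empty [CompleteSpace A] (k : ℕ) :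
    𝒮.idemRank k IdemMatrix.empty = 0 := by
  have h : ‖(0 : Matrix (Fin 0) (Fin 0) (𝒮.sub k)).map (𝒮.sub k).subtype - 0‖ < 1 / 2 := by
    rw [Matrix.map_zero _ (map_zero _), sub_self, norm_zero]
    exact one_half_pos
  have hnear : 𝒮.IsNear k (IdemMatrix.empty : IdemMatrix A).mat
    (0 : Matrix (Fin 0) (Fin 0) (𝒮.sub k)) := ⟨IsIdempotentElem.zero, h⟩
  rw [hnear.idemRank_eq, ← Nat.cast_inj (R := ℂ)]
  refine (repRank_eq_trace _ IsIdempotentElem.zero).trans ?_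
  change ((𝒮.rep k) (Matrix.trace (0 : Matrix (Fin 0) (Fin 0) (𝒮.sub k)))).trace = _
  simp

/-- The germ at infinity of the sequence of ranks of a class of idempotents. -/
noncomputable def rankGerm [CompleteSpace A] : IdemClass A → Germ (atTop : Filter ℕ) ℤ :=
  Quotient.lift (fun e => ((fun k => (𝒮.idemRank k e : ℤ) : ℕ → ℤ) : Germ atTop ℤ))
    fun e e' h => Germ.coe_eq.2 (by
      filter_upwards [𝒮.eventually_idemRank_le h, 𝒮.eventually_idemRank_le (AlgEquivalent.symm h)]
        with k h1 h2
      rw [le_antisymm h1 h2])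

/-- The ranks at the stages `k`, as a homomorphism from the monoid of classes of idempotents to the
group of germs at infinity of integer sequences. -/
noncomputable def rankHom [CompleteSpace A] : IdemClass A →+ Germ (atTop : Filter ℕ) ℤ where
  toFun := 𝒮.rankGerm
  map_zero' := by
    refine (Germ.coe_eq (f := fun k => (𝒮.idemRank k IdemMatrix.empty : ℤ))
      (g := fun _ => 0)).2 (Eventually.of_forall fun k => ?_)
    simp [𝒮.idemRank_empty k]
  map_add' a b := Quotient.inductionOn₂ a b fun e e' => Germ.coe_eq.2 (by
    filter_upwards [𝒮.eventually_idemRank_sum e e'] with k hk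
    rw [hk]
    push_cast
    rfl)

/-- If the class of the unit is divisible by `q` in `K₀`, then the sizes of the matrix
representations are eventually divisible by `q`. -/
theorem eventually_dvd_card (𝒮 : MatricialApproximation A ι) [CompleteSpace A] {q : ℕ} {a : KZero A} (h : q • a = kUnit A) :
    ∀ᶠ k in atTop, q ∣ Fintype.card (ι k) := by
  have h0 : Algebra.GrothendieckAddGroup.lift 𝒮.rankHom (kUnit A)
      = 𝒮.rankHom (Quotient.mk _ IdemMatrix.unit) := GrothendieckAddGroup.lift_of _ _
  have h1 := congrArg (Algebra.GrothendieckAddGroup.lift 𝒮.rankHom) h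
  rw [map_nsmul, h0] at h1
  -- Only the fact that the image of `a` is the germ of some integer sequence is needed: `q` times
  -- that sequence is eventually the sequence of sizes.
  generalize Algebra.GrothendieckAddGroup.lift 𝒮.rankHom a = g at h1
  induction g using Germ.inductionOn with | _ g
  have h2 := (Germ.coe_eq (f := fun k => q • g k)
    (g := fun k => (𝒮.idemRank k IdemMatrix.unit : ℤ))).1 h1
  filter_upwards [h2] with k hk
  rw [𝒮.idemRank_unit] at hk
  rw [← Int.natCast_dvd_natCast, ← hk]
  exact ⟨g k, by simp⟩

end MatricialApproximation

end RankHom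

/-! ### The uniform Roe algebra of a locally finite group -/

section RoeApproximation

open Filter

variable {p : ℝ≥0} [Fact (1 ≤ (p : ℝ≥0∞))]

section Coefficients

variable {X : Type*}

theorem continuous_coeff (x y : X) : Continuous fun T : SeqOp p X => coeff T x y :=
  (lp.evalCLM ℂ (fun _ : X => ℂ) (p : ℝ≥0∞) x).continuous.comp
    (ContinuousLinearMap.apply ℂ (SeqSpace p X) _).continuous

/-- As `p` is finite, the expansion of `T δ_y` in the standard basis converges in norm, so `S` and
evaluation at `x` can be applied termwise. -/
theorem hasSum_coeff_mul (S T : SeqOp p X) (x y : X) :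
    HasSum (fun z => coeff S x z * coeff T z y) (coeff (S * T) x y) := by
  classical
  set ξ : SeqSpace p X := T (lp.single (p : ℝ≥0∞) y (1 : ℂ)) with hξ
  have hsum : HasSum (fun z : X => lp.single (p : ℝ≥0∞) z (ξ z)) ξ :=
    lp.hasSum_single ENNReal.coe_ne_top ξ
  have hS := (hsum.mapL S).mapL (lp.evalCLM ℂ (fun _ : X => ℂ) (p : ℝ≥0∞) x)
  refine hS.congr_fun fun z => ?_
  have h1 : lp.single (E := fun _ : X => ℂ) (p : ℝ≥0∞) z (ξ z)
      = ξ z • lp.single (E := fun _ : X => ℂ) (p : ℝ≥0∞) z (1 : ℂ) := by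
    rw [← lp.single_smul]; simp
  rw [h1, map_smul, map_smul, smul_eq_mul, mul_comm]
  rfl

end Coefficients

-- Block diagonal operators over the cosets of a subgroup.

variable {G : Type*} [Group G] [MetricSpace G]

/-- The subring of the operators in the uniform Roe algebra which are block diagonal for the
partition into left cosets of a subgroup. -/
def cosetSubring (p : ℝ≥0) [Fact (1 ≤ (p : ℝ≥0∞))] (H : Subgroup G) :
    Subring (uniformRoe p G) where
  carrier := {T | ∀ x y, coeff (T : SeqOp p G) x y ≠ 0 → x⁻¹ * y ∈ H}
  mul_mem' := by
    intro S T hS hT x y h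
    obtain ⟨z, h1, h2⟩ := exists_coeff_ne_zero_of_mul _ _ x y h
    simpa [mul_assoc] using mul_mem (hS x z h1) (hT z y h2)
  one_mem' := by
    classical
    intro x y h
    have h1 := coeff_algebraMap (p := p) 1 x y
    rw [map_one] at h1
    have hxy : x = y := by
      by_contra hne
      exact h (h1.trans (if_neg hne))
    simp [hxy, one_mem]
  add_mem' := by
    intro S T hS hT x y h
    by_cases h1 : coeff (S : SeqOp p G) x y = 0
    · refine hT x y fun h2 => h ?_
      exact (coeff_add _ _ x y).trans (by rw [h1, h2, add_zero])
    · exact hS x y h1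
  zero_mem' := fun x y h => absurd rfl h
  neg_mem' := by
    intro T hT x y h
    refine hT x y fun h1 => h ?_
    change -coeff (T : SeqOp p G) x y = 0
    rw [h1, neg_zero]

theorem mem_cosetSubring {H : Subgroup G} {T : uniformRoe p G} :
    T ∈ cosetSubring p H ↔ ∀ x y, coeff (T : SeqOp p G) x y ≠ 0 → x⁻¹ * y ∈ H := Iff.rfl

theorem isClosed_cosetSubring (H : Subgroup G) :
    IsClosed (cosetSubring p H : Set (uniformRoe p G)) := by
  have : (cosetSubring p H : Set (uniformRoe p G))
      = ⋂ (x : G) (y : G) (_ : x⁻¹ * y ∉ H),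
        {T : uniformRoe p G | coeff (T : SeqOp p G) x y = 0} := by
    ext T
    simp only [SetLike.mem_coe, mem_cosetSubring, Set.mem_iInter, Set.mem_ofPred_eq]
    exact forall₂_congr fun x y => not_imp_comm
  rw [this]
  refine isClosed_iInter fun x => isClosed_iInter fun y => isClosed_iInter fun _ => ?_
  exact isClosed_eq ((continuous_coeff x y).comp continuous_subtype_val) continuous_const

/-- The representation of the block diagonal operators on the block of the identity. -/
noncomputable def cosetRep (p : ℝ≥0) [Fact (1 ≤ (p : ℝ≥0∞))] (H : Subgroup G) [Fintype H]
    [DecidableEq H] : cosetSubring p H →+* Matrix H H ℂ where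
  toFun T := Matrix.of fun x y => coeff (T : SeqOp p G) x y
  map_one' := by
    classical
    ext x y
    have h1 := coeff_algebraMap (p := p) 1 (x : G) y
    rw [map_one] at h1
    refine h1.trans ?_
    simp [Matrix.one_apply]
  map_zero' := rfl
  map_add' _ _ := rfl
  map_mul' S T := by
    classical
    ext x y
    have h := hasSum_coeff_mul ((S : uniformRoe p G) : SeqOp p G) (T : uniformRoe p G) (x : G) y
    -- For `x ∈ H`, block diagonality confines the series for the product to `z ∈ H`, which leaves
    -- the finite matrix product.
    have h0 : ∀ z ∉ Set.range ((↑) : H → G), coeff ((S : uniformRoe p G) : SeqOp p G) x z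
        * coeff ((T : uniformRoe p G) : SeqOp p G) z y = 0 := by
      intro z hz
      rw [mul_eq_zero]
      left
      by_contra hne
      refine hz ⟨⟨z, ?_⟩, rfl⟩
      simpa using mul_mem x.2 (S.2 x z hne)
    have h' := (Function.Injective.hasSum_iff Subtype.val_injective h0).2 h
    exact h'.unique (hasSum_fintype _)

variable [IsIsometricSMul G G]

open Classical in
/-- The uniform Roe algebra of a locally finite group is approximated by the block diagonal
operators for the finite subgroups generated by balls. -/
noncomputable def roeApproximation (p : ℝ≥0) [Fact (1 ≤ (p : ℝ≥0∞))]
    [∀ n, Fintype (ballSubgroup G n)] :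
    MatricialApproximation (uniformRoe p G) fun n => ballSubgroup G n where
  sub n := cosetSubring p (ballSubgroup G n)
  isClosed n := isClosed_cosetSubring _
  dense T ε hε := by
    -- An operator of propagation at most `R` is already block diagonal over the ball subgroups of
    -- radius `k ≥ R`, so one approximant serves all late stages.
    obtain ⟨S, hS, hST⟩ := Metric.mem_closure_iff.1 T.2 ε hε
    obtain ⟨R, _, hR⟩ := mem_finitePropagation_iff.1 hS
    obtain ⟨n, hn⟩ := exists_nat_ge R
    filter_upwards [eventually_ge_atTop n] with k hk
    refine ⟨⟨S, Subalgebra.le_topologicalClosure _ hS⟩, fun x y hxy => ?_, ?_⟩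
    · exact inv_mul_mem_ballSubgroup ((hR x y hxy).trans (hn.trans (by exact_mod_cast hk)))
    · rw [dist_comm, dist_eq_norm] at hST
      exact hST
  rep n := cosetRep p _

theorem completeSpace_uniformRoe (X : Type*) [MetricSpace X] : CompleteSpace (uniformRoe p X) :=
  (Subalgebra.isClosed_topologicalClosure (finitePropagation p X)).completeSpace_coe

theorem exists_dvd_card_ballSubgroup (hG : IsLocallyFiniteGroup G) (hGp : HasFiniteBalls G) {q : ℕ}
    {a : KZero (uniformRoe p G)} (h : q • a = kUnit (uniformRoe p G)) :
    ∃ n, q ∣ Nat.card (ballSubgroup G n) := by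
  classical
  have := finite_ballSubgroup hG hGp
  have := fun n => Fintype.ofFinite (ballSubgroup G n)
  have := completeSpace_uniformRoe (p := p) G
  obtain ⟨n, hn⟩ := ((roeApproximation p).eventually_dvd_card h).exists
  exact ⟨n, by rwa [Nat.card_eq_fintype_card]⟩

variable {L : Type*} [Group L] [MetricSpace L] [IsIsometricSMul L L]

theorem KZeroUnitIso.exists_card_dvd (hG : IsLocallyFiniteGroup G) (hGp : HasFiniteBalls G)
    (hL : IsLocallyFiniteGroup L) (hLp : HasFiniteBalls L)
    (h : KZeroUnitIso (uniformRoe p G) (uniformRoe p L)) (n : ℕ) :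
    ∃ m, Nat.card (ballSubgroup G n) ∣ Nat.card (ballSubgroup L m) := by
  obtain ⟨φ, hφ⟩ := h
  have := finite_ballSubgroup hG hGp
  obtain ⟨a, ha⟩ := exists_card_nsmul_eq_kUnit (p := p) (ballSubgroup G n)
  refine exists_dvd_card_ballSubgroup hL hLp (p := p) (a := φ a) ?_
  rw [← map_nsmul, ha, hφ]

theorem KZeroUnitIso.symm {A B : Type*} [Ring A] [Ring B] (h : KZeroUnitIso A B) :
    KZeroUnitIso B A := by
  obtain ⟨φ, hφ⟩ := h
  exact ⟨φ.symm, by rw [← hφ, φ.symm_apply_apply]⟩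

theorem KZeroUnitIso.bijectivelyCoarselyEquivalent
    (hG : IsLocallyFiniteGroup G) (hGp : HasFiniteBalls G)
    (hL : IsLocallyFiniteGroup L) (hLp : HasFiniteBalls L)
    (h : KZeroUnitIso (uniformRoe p G) (uniformRoe p L)) : BijectivelyCoarselyEquivalent G L :=
  bijectivelyCoarselyEquivalent_of_card_dvd hG hGp hL hLp
    (h.exists_card_dvd hG hGp hL hLp) (h.symm.exists_card_dvd hL hLp hG hGp)

end RoeApproximation

-- The equivalence of the nine conditions.

theorem mainTheorem8 {Γ : Type*} {Λ : Type*}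
    [Group Γ] [Countable Γ] [MetricSpace Γ] [IsIsometricSMul Γ Γ]
    [Group Λ] [Countable Λ] [MetricSpace Λ] [IsIsometricSMul Λ Λ]
    (hΓ : IsLocallyFiniteGroup Γ) (hΓp : HasFiniteBalls Γ)
    (hΛ : IsLocallyFiniteGroup Λ) (hΛp : HasFiniteBalls Λ) :
    List.TFAE
      [BijectivelyCoarselyEquivalent Γ Λ,
       ∀ (p : ℝ≥0) [Fact (1 ≤ (p : ℝ≥0∞))], RoeDiagonalIso p Γ Λ,
       ∀ (p : ℝ≥0) [Fact (1 ≤ (p : ℝ≥0∞))], RoeIso p Γ Λ,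
       ∃ (p : ℝ≥0) (_ : Fact (1 ≤ (p : ℝ≥0∞))), RoeIso p Γ Λ,
       ∃ (p : ℝ≥0) (_ : Fact (1 ≤ (p : ℝ≥0∞))), RoeDiagonalIso p Γ Λ,
       ∀ (p : ℝ≥0) [Fact (1 ≤ (p : ℝ≥0∞))],
         KZeroOrderedUnitIso (uniformRoe p Γ) (uniformRoe p Λ),
       ∃ (p : ℝ≥0) (_ : Fact (1 ≤ (p : ℝ≥0∞))),
         KZeroOrderedUnitIso (uniformRoe p Γ) (uniformRoe p Λ),
       ∀ (p : ℝ≥0) [Fact (1 ≤ (p : ℝ≥0∞))],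
         KZeroUnitIso (uniformRoe p Γ) (uniformRoe p Λ),
       ∃ (p : ℝ≥0) (_ : Fact (1 ≤ (p : ℝ≥0∞))),
         KZeroUnitIso (uniformRoe p Γ) (uniformRoe p Λ)] := by
  -- The exponent 1 serves as witness whenever "for every `p`" is weakened to "for some `p`".
  have h₁ : Fact (1 ≤ ((1 : ℝ≥0) : ℝ≥0∞)) := ⟨by simp⟩
  tfae_have 1 → 2 := fun h _ _ => RoeDiagonalIso.of_bijectivelyCoarselyEquivalent h
  tfae_have 2 → 3 := fun h p _ => (h p).imp fun _ hφ => hφ.1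
  tfae_have 3 → 4 := fun h => ⟨1, h₁, h 1⟩
  tfae_have 2 → 5 := fun h => ⟨1, h₁, h 1⟩
  tfae_have 5 → 4 := fun ⟨p, hp, φ, hφ⟩ => ⟨p, hp, φ, hφ.1⟩
  tfae_have 3 → 6 := fun h p _ => KZeroOrderedUnitIso.of_ringEquiv (h p).choose.toRingEquiv
  tfae_have 4 → 7 := fun ⟨p, hp, φ, _⟩ =>
    ⟨p, hp, KZeroOrderedUnitIso.of_ringEquiv φ.toRingEquiv⟩
  tfae_have 6 → 8 := fun h p _ => (h p).imp fun _ hφ => hφ.2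
  tfae_have 7 → 9 := fun ⟨p, hp, φ, hφ⟩ => ⟨p, hp, φ, hφ.2⟩
  tfae_have 8 → 9 := fun h => ⟨1, h₁, h 1⟩
  -- This closes the cycle: the weakest condition recovers the geometry, and with it the statements
  -- for every `p`.
  tfae_have 9 → 1 := fun ⟨_, _, h⟩ => h.bijectivelyCoarselyEquivalent hΓ hΓp hΛ hΛp
  tfae_finish
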